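/- Let $A$, $J$, $B$ be nonzero finite-dimensional complex Hilbert spaces, and let $\mathcal N:\mathcal L(A\otimes J)\to\mathcal L(B)$ be a completely positive trace preserving (cptp) map (a quantum arbitrarily varying channel, QAVC, with sender $A$, jammer $J$ and receiver $B$). For a block length $\ell$ and a state $\sigma$ on $J^{\otimes\ell}$ (not necessarily a product state) put $\mathcal N^{\otimes\ell}_\sigma(\rho)=\mathcal N^{\otimes\ell}(\rho\otimes\sigma)$ for $\rho\in\mathcal L(A^{\otimes\ell})$. A deterministic classical code $\mathcal C$ of block length $\ell$ and size $M$ consists of states $\rho_1,\dots,\rho_M$ on $A^{\otimes\ell}$ and operators $D_1,\dots,D_M\ge 0$ on $B^{\otimes\ell}$ with $\sum_m D_m=\mathbb 1$; its error against $\sigma$ is $$P_{\mathrm{err}}(\mathcal C,\sigma)=\frac1M\sum_{m=1}^M\operatorname{tr}\bigl(\mathcal N^{\otimes\ell}(\rho_m\otimes\sigma)(\mathbb 1-D_m)\bigr).$$ A deterministic quantum code $\mathcal Q$ of block length $\ell$ and size $L$ is a pair of cptp maps $\mathcal E:\mathcal L(\mathbb C^L)\to\mathcal L(A^{\otimes\ell})$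 and $\mathcal D:\mathcal L(B^{\otimes\ell})\to\mathcal L(\mathbb C^L)$; its infidelity against $\sigma$ is $$\widehat F(\mathcal Q,\sigma)=1-\operatorname{tr}\Bigl(\bigl((\mathrm{id}\otimes\mathcal D\circ\mathcal N^{\otimes\ell}_\sigma\circ\mathcal E)\Phi_L\bigr)\Phi_L\Bigr),\qquad \Phi_L=\frac1L\sum_{i,j}|ii\rangle\langle jj|.$$ A random classical (quantum) code of block length $\ell$ and size $M$ (resp. $L$) is a family of deterministic codes $\mathcal C_\lambda$ (resp. $\mathcal Q_\lambda$) of that block length and size indexed by a random variable $\lambda$; its error against $\sigma$ is the expectation $\mathbb E_\lambda P_{\mathrm{err}}(\mathcal C_\lambda,\sigma)$ (resp. $\mathbb E_\lambda\widehat F(\mathcal Q_\lambda,\sigma)$). Let $C_{\mathrm{det}}(\mathcal N)$ (resp. $C_{\mathrm{rand}}(\mathcal N)$) be the supremum of $\limsup_{\ell\to\infty}\frac1\ell\log_2 M_\ell$ over all sequences, indexed by $\ell$, of deterministic (resp. random) classical codes of block length $\ell$ and size $M_\ell$ whose worst-case error, the supremum over all states $\sigma$ on $J^{\otimes\ell}$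 of the error against $\sigma$, tends to $0$ as $\ell\to\infty$. Define $Q_{\mathrm{det}}(\mathcal N)$ and $Q_{\mathrm{rand}}(\mathcal N)$ in the same way from deterministic and random quantum codes of size $L_\ell$ and the infidelity. Then $$C_{\mathrm{det}}(\mathcal N)=\begin{cases}C_{\mathrm{rand}}(\mathcal N)&\text{if }C_{\mathrm{det}}(\mathcal N)>0,\\0&\text{otherwise,}\end{cases}\qquad Q_{\mathrm{det}}(\mathcal N)=\begin{cases}Q_{\mathrm{rand}}(\mathcal N)&\text{if }C_{\mathrm{det}}(\mathcal N)>0,\\0&\text{otherwise.}\end{cases}$$ -/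

import Mathlib

noncomputable section

open scoped Kronecker ComplexOrder

namespace QAVC

/-! A finite-dimensional Hilbert space with a fixed orthonormal basis is represented by the finite
index type of the basis; operators on it are complex matrices. The tensor product of two systems is
indexed by the product type, and the `ℓ`-fold tensor power of `a` by `Fin ℓ → a`. -/

/-- Linear maps `L(a) → L(b)` between operator spaces. -/
abbrev SuperOp (a b : Type*) : Type _ := Matrix a a ℂ →ₗ[ℂ] Matrix b b ℂ

section Maps

variable {r a b : Type*}

/-- The map `id_r ⊗ Φ`: it applies `Φ` to each of the `r × r` blocks. -/
def idTensor (Φ : SuperOp a b) (X : Matrix (r × a) (r × a) ℂ) : Matrix (r × b) (r × b) ℂ :=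
  Matrix.of fun p q => Φ (Matrix.of fun x y => X (p.1, x) (q.1, y)) p.2 q.2

variable [Fintype a]

/-- Completely positive and trace preserving maps. -/
structure IsCPTP [Fintype b] (Φ : SuperOp a b) : Prop where
  completelyPositive : ∀ (k : ℕ) (X : Matrix (Fin k × a) (Fin k × a) ℂ),
    X.PosSemidef → (idTensor Φ X).PosSemidef
  tracePreserving : ∀ X : Matrix a a ℂ, (Φ X).trace = X.trace

/-- The set `S(a)` of states (density operators). -/
def State (a : Type*) [Fintype a] : Type _ :=
  {ρ : Matrix a a ℂ // ρ.PosSemidef ∧ ρ.trace = 1}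

variable [DecidableEq a]

/-- The tensor power `Φ^{⊗ℓ}`, given by linear extension from the matrix units
`⊗ᵢ |xᵢ⟩⟨x'ᵢ| ↦ ⊗ᵢ Φ(|xᵢ⟩⟨x'ᵢ|)`. -/
def tensorPow (Φ : SuperOp a b) (ℓ : ℕ) : SuperOp (Fin ℓ → a) (Fin ℓ → b) where
  toFun X := Matrix.of fun y y' => ∑ x : Fin ℓ → a, ∑ x' : Fin ℓ → a,
    X x x' * ∏ i, Φ (Matrix.single (x i) (x' i) 1) (y i) (y' i)
  map_add' X Y := by
    ext y y'
    simp [add_mul, Finset.sum_add_distrib]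
  map_smul' c X := by
    ext y y'
    simp [Finset.mul_sum, mul_assoc]

/-- `Φ^{⊗ℓ}(X₁ ⊗ ⋯ ⊗ X_ℓ) = Φ(X₁) ⊗ ⋯ ⊗ Φ(X_ℓ)`. -/
theorem tensorPow_product (Φ : SuperOp a b) (ℓ : ℕ) (X : Fin ℓ → Matrix a a ℂ) :
    tensorPow Φ ℓ (Matrix.of fun x x' => ∏ i, X i (x i) (x' i)) =
      Matrix.of fun y y' => ∏ i, Φ (X i) (y i) (y' i) := by
  ext y y'
  have key : ∀ i, Φ (X i) (y i) (y' i) =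
      ∑ p : a, ∑ q : a, X i p q * Φ (Matrix.single p q 1) (y i) (y' i) := by
    intro i
    conv_lhs => rw [Matrix.matrix_eq_sum_single (X i)]
    simp only [map_sum, Matrix.sum_apply]
    refine Finset.sum_congr rfl fun p _ => Finset.sum_congr rfl fun q _ => ?_
    have : Matrix.single p q (X i p q) = X i p q • Matrix.single p q (1 : ℂ) := by simp
    rw [this, map_smul, Matrix.smul_apply, smul_eq_mul]
  simp only [tensorPow, LinearMap.coe_mk, AddHom.coe_mk, Matrix.of_apply, key,
    ← Finset.prod_mul_distrib]
  rw [Finset.prod_univ_sum]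
  simp only [Finset.prod_univ_sum, Fintype.piFinset_univ]

end Maps

section Channel

variable {a j b : Type*} [Fintype a] [DecidableEq a] [Fintype j] [DecidableEq j] [Fintype b]

/-- The block channel `N^{⊗ℓ} : L(A^ℓ ⊗ J^ℓ) → L(B^ℓ)` of `N : L(A ⊗ J) → L(B)`. -/
def blockChannel (N : SuperOp (a × j) b) (ℓ : ℕ) :
    SuperOp ((Fin ℓ → a) × (Fin ℓ → j)) (Fin ℓ → b) :=
  tensorPow N ℓ ∘ₗ (Matrix.reindexLinearEquiv ℂ ℂ
    (Equiv.arrowProdEquivProdArrow (Fin ℓ) (fun _ => a) (fun _ => j)).symm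
    (Equiv.arrowProdEquivProdArrow (Fin ℓ) (fun _ => a) (fun _ => j)).symm).toLinearMap

/-- The channel `N^{⊗ℓ}_σ : L(A^ℓ) → L(B^ℓ)`, `ρ ↦ N^{⊗ℓ}(ρ ⊗ σ)`, for a jammer state `σ` on
`J^ℓ`. -/
def jammed (N : SuperOp (a × j) b) (ℓ : ℕ) (σ : State (Fin ℓ → j)) :
    SuperOp (Fin ℓ → a) (Fin ℓ → b) where
  toFun ρ := blockChannel N ℓ (ρ ⊗ₖ σ.1)
  map_add' ρ ρ' := by rw [Matrix.add_kronecker, map_add]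
  map_smul' c ρ := by rw [Matrix.smul_kronecker, map_smul, RingHom.id_apply]

end Channel

/-- A deterministic classical code of block length `ℓ` with `M` messages. -/
structure ClassicalCode (a b : Type*) [Fintype a] [Fintype b] [DecidableEq b] (ℓ M : ℕ) where
  /-- the signal states -/
  ρ : Fin M → State (Fin ℓ → a)
  /-- the decoding measurement -/
  D : Fin M → Matrix (Fin ℓ → b) (Fin ℓ → b) ℂ
  posSemidef : ∀ m, (D m).PosSemidef
  sum_eq_one : ∑ m, D m = 1

/-- A deterministic quantum code of block length `ℓ` for an `L`-dimensional system. -/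
structure QuantumCode (a b : Type*) [Fintype a] [Fintype b] (ℓ L : ℕ) where
  /-- the encoder -/
  E : SuperOp (Fin L) (Fin ℓ → a)
  /-- the decoder -/
  D : SuperOp (Fin ℓ → b) (Fin L)
  isCPTP_E : IsCPTP E
  isCPTP_D : IsCPTP D

/-- The maximally entangled state `Φ_L = (1/L) ∑_{i,j} |ii⟩⟨jj|`. -/
def maxEntangled (L : ℕ) : Matrix (Fin L × Fin L) (Fin L × Fin L) ℂ :=
  Matrix.of fun p q => if p.1 = p.2 ∧ q.1 = q.2 then (L : ℂ)⁻¹ else 0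

section Errors

variable {a j b : Type*} [Fintype a] [DecidableEq a] [Fintype j] [DecidableEq j]
  [Fintype b]

/-- The average error probability of a classical code against the jammer state `σ`. -/
def ClassicalCode.err [DecidableEq b] {ℓ M : ℕ} (C : ClassicalCode a b ℓ M) (N : SuperOp (a × j) b)
    (σ : State (Fin ℓ → j)) : ℝ :=
  (1 / M : ℝ) * ∑ m, (jammed N ℓ σ (C.ρ m).1 * (1 - C.D m)).trace.re

/-- The infidelity of a quantum code against the jammer state `σ`. -/
def QuantumCode.infid {ℓ L : ℕ} (Q : QuantumCode a b ℓ L) (N : SuperOp (a × j) b)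
    (σ : State (Fin ℓ → j)) : ℝ :=
  1 - (idTensor (Q.D ∘ₗ jammed N ℓ σ ∘ₗ Q.E) (maxEntangled L) * maxEntangled L).trace.re

end Errors

section Random

variable {a j b : Type*} [Fintype a] [DecidableEq a] [Fintype j] [DecidableEq j]
  [Fintype b]

/-- A random classical code for `N`: a random variable with values in `Λ` and distribution `P`, and
deterministic codes indexed by `Λ` whose expected error probability exists for every jammer
state. -/
structure RandomClassicalCode [DecidableEq b] (N : SuperOp (a × j) b) (ℓ M : ℕ) where
  Λ : Type
  mΛ : MeasurableSpace Λ
  P : MeasureTheory.Measure Λ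
  isProb : MeasureTheory.IsProbabilityMeasure P
  code : Λ → ClassicalCode a b ℓ M
  integrable : ∀ σ : State (Fin ℓ → j), MeasureTheory.Integrable (fun t => (code t).err N σ) P

/-- The expected error probability of a random classical code. -/
def RandomClassicalCode.err [DecidableEq b] {N : SuperOp (a × j) b} {ℓ M : ℕ}
    (C : RandomClassicalCode N ℓ M) (σ : State (Fin ℓ → j)) : ℝ :=
  letI := C.mΛ
  ∫ t, (C.code t).err N σ ∂C.P

/-- A random quantum code for `N`. -/
structure RandomQuantumCode (N : SuperOp (a × j) b) (ℓ L : ℕ) where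
  Λ : Type
  mΛ : MeasurableSpace Λ
  P : MeasureTheory.Measure Λ
  isProb : MeasureTheory.IsProbabilityMeasure P
  code : Λ → QuantumCode a b ℓ L
  integrable : ∀ σ : State (Fin ℓ → j), MeasureTheory.Integrable (fun t => (code t).infid N σ) P

/-- The expected infidelity of a random quantum code. -/
def RandomQuantumCode.infid {N : SuperOp (a × j) b} {ℓ L : ℕ} (Q : RandomQuantumCode N ℓ L)
    (σ : State (Fin ℓ → j)) : ℝ :=
  letI := Q.mΛ
  ∫ t, (Q.code t).infid N σ ∂Q.P

end Random

/-- The asymptotic rate `limsup_ℓ (1/ℓ) log₂ (K ℓ)` of code sizes `K`. -/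
def asympRate (K : ℕ → ℕ) : EReal :=
  Filter.limsup (fun ℓ => ((Real.logb 2 (K ℓ) / ℓ : ℝ) : EReal)) Filter.atTop

/-- The worst-case errors `sup_σ err ℓ σ` over the jammer states on `J^ℓ` tend to `0` as
`ℓ → ∞`. -/
def ErrorVanishes {j : Type*} [Fintype j] (err : ∀ ℓ : ℕ, State (Fin ℓ → j) → ℝ) : Prop :=
  Filter.Tendsto (fun ℓ => ⨆ σ : State (Fin ℓ → j), (err ℓ σ : EReal)) Filter.atTop (nhds 0)

section Capacities

variable {a j b : Type*} [Fintype a] [DecidableEq a] [Fintype j] [DecidableEq j]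
  [Fintype b]

/-- The deterministic classical capacity. -/
def Cdet [DecidableEq b] (N : SuperOp (a × j) b) : EReal :=
  sSup {R | ∃ (M : ℕ → ℕ) (C : ∀ ℓ, ClassicalCode a b ℓ (M ℓ)),
    ErrorVanishes (fun ℓ σ => (C ℓ).err N σ) ∧ R = asympRate M}

/-- The random coding classical capacity. -/
def Crand [DecidableEq b] (N : SuperOp (a × j) b) : EReal :=
  sSup {R | ∃ (M : ℕ → ℕ) (C : ∀ ℓ, RandomClassicalCode N ℓ (M ℓ)),
    ErrorVanishes (fun ℓ σ => (C ℓ).err σ) ∧ R = asympRate M}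

/-- The deterministic quantum capacity. -/
def Qdet (N : SuperOp (a × j) b) : EReal :=
  sSup {R | ∃ (L : ℕ → ℕ) (Q : ∀ ℓ, QuantumCode a b ℓ (L ℓ)),
    ErrorVanishes (fun ℓ σ => (Q ℓ).infid N σ) ∧ R = asympRate L}

/-- The random coding quantum capacity. -/
def Qrand (N : SuperOp (a × j) b) : EReal :=
  sSup {R | ∃ (L : ℕ → ℕ) (Q : ∀ ℓ, RandomQuantumCode N ℓ (L ℓ)),
    ErrorVanishes (fun ℓ σ => (Q ℓ).infid σ) ∧ R = asympRate L}

end Capacities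

end QAVC

end

/-! The error (or infidelity) of a code against a jammer state `σ` is `tr (σ X)` for an operator
`0 ≤ X ≤ 1` on `J^ℓ`, so an error of at most `ε` against all, also entangled, jammer states means
`X ≤ ε • 1`. For a random code the mean of `X` is at most `ε • 1`. In the `p`-th even trace moment
of a sum of `K` independent centred copies of `X` only the words in which no letter occurs exactly
once contribute. With `p = n` and `K` polynomial in the block length `n`, this moment is small
enough to beat the dimension of `J^n`, which is exponential in `n`, and so there are `K`
deterministic codes whose average error operator is at most `(ε + O(1/n)) • 1`.

If `Cdet N > 0`, some block length has two signals and a test with errors at most `1/8`, and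
repetition, which alternately squares one of the errors while it doubles the other, makes these
errors at most a constant times `2 ^ (-2 ^ r)` at length `O(4 ^ r)`. So the `O(log n)` bits of a
uniformly random index of one of the `K` codes can be sent in front of that code at length
`O((log n) ^ 3)`, without loss of rate.

Finally, `Qdet N ≤ Cdet N`, because the basis states sent through a quantum code form a classical
code. -/

noncomputable section

open scoped Kronecker ComplexOrder MatrixOrder BigOperators
open Matrix

namespace QAVC

section PosSemidef

theorem single_self_nonneg {n : Type*} [Finite n] [DecidableEq n] (x : n) :
    (0 : Matrix n n ℂ) ≤ single x x 1 := by
  have := Fintype.ofFinite n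
  have h : single x x (1 : ℂ) = vecMulVec (Pi.single x 1) (star (Pi.single x 1)) := by
    rw [← Pi.single_star, star_one, single_eq_single_vecMulVec_single]
  exact h ▸ (posSemidef_vecMulVec_self_star _).nonneg

variable {n : Type*} [Fintype n]

theorem exists_eq_conjTranspose_mul_self {A : Matrix n n ℂ} (hA : 0 ≤ A) :
    ∃ B : Matrix n n ℂ, A = Bᴴ * B := by
  classical
  exact CStarAlgebra.nonneg_iff_eq_star_mul_self.1 hA

theorem trace_mul_nonneg {A B : Matrix n n ℂ} (hA : 0 ≤ A) (hB : 0 ≤ B) : 0 ≤ (A * B).trace := by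
  obtain ⟨C, rfl⟩ := exists_eq_conjTranspose_mul_self hB
  rw [← Matrix.mul_assoc, Matrix.trace_mul_comm, ← Matrix.mul_assoc]
  exact (hA.posSemidef.mul_mul_conjTranspose_same C).trace_nonneg

theorem nonneg_of_dotProduct_mulVec_nonneg {A : Matrix n n ℂ}
    (h : ∀ v : n → ℂ, 0 ≤ star v ⬝ᵥ A *ᵥ v) : 0 ≤ A := by
  classical
  rw [nonneg_iff_posSemidef, ← isPositive_toEuclideanLin_iff, LinearMap.isPositive_iff_complex]
  intro x
  have hinner : inner ℂ (toEuclideanLin A x) x = star x.ofLp ⬝ᵥ A *ᵥ x.ofLp := by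
    rw [← (IsSelfAdjoint.of_nonneg (h x.ofLp)).star_eq, ← star_dotProduct_star, star_star,
      EuclideanSpace.inner_eq_star_dotProduct, dotProduct_comm]
    rfl
  rw [hinner]
  exact ⟨(Complex.eq_re_of_ofReal_le (h x.ofLp)).symm, (Complex.le_def.1 (h x.ofLp)).1⟩

end PosSemidef

section KrausMaps

variable {a b c κ : Type*}

/-- Complete positivity, the first half of `IsCPTP`. -/
def IsCP (Φ : SuperOp a b) : Prop :=
  ∀ (k : ℕ) (X : Matrix (Fin k × a) (Fin k × a) ℂ), X.PosSemidef → (idTensor Φ X).PosSemidef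

/-- The map `X ↦ ∑ₖ Kₖ X Kₖ*` with Kraus operators `Kₖ`. -/
def kraus [Fintype a] [Fintype κ] (K : κ → Matrix b a ℂ) : SuperOp a b :=
  ∑ k, mulRightLinearMap b ℂ (K k)ᴴ ∘ₗ mulLeftLinearMap a ℂ (K k)

theorem kraus_apply [Fintype a] [Fintype κ] (K : κ → Matrix b a ℂ) (X : Matrix a a ℂ) :
    kraus K X = ∑ k, K k * X * (K k)ᴴ := by
  simp [kraus]

theorem kraus_single_apply [Fintype a] [DecidableEq a] [Fintype κ] (K : κ → Matrix b a ℂ)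
    (x x' : a) (y y' : b) :
    kraus K (single x x' 1) y y' = ∑ k, K k y x * star (K k y' x') := by
  simp [kraus_apply, Matrix.sum_apply, Matrix.mul_apply, single_apply, ite_and]

theorem SuperOp.ext [Finite a] [DecidableEq a] {Φ Ψ : SuperOp a b}
    (h : ∀ x x' y y', Φ (single x x' 1) y y' = Ψ (single x x' 1) y y') : Φ = Ψ := by
  have := Fintype.ofFinite a
  exact Matrix.ext_linearMap ℂ fun x x' => LinearMap.ext_ring <| Matrix.ext <| h x x'

theorem IsCP.comp {Ψ : SuperOp b c} {Φ : SuperOp a b} (hΨ : IsCP Ψ) (hΦ : IsCP Φ) :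
    IsCP (Ψ ∘ₗ Φ) :=
  fun k _ hX => hΨ k _ (hΦ k _ hX)

theorem isCP_kraus [Fintype a] [Finite b] [Fintype κ] (K : κ → Matrix b a ℂ) :
    IsCP (kraus K) := by
  classical
  have := Fintype.ofFinite b
  intro r X hX
  have h : idTensor (kraus K) X = ∑ k, ((1 : Matrix (Fin r) (Fin r) ℂ) ⊗ₖ K k) * X *
      ((1 : Matrix (Fin r) (Fin r) ℂ) ⊗ₖ K k)ᴴ := by
    ext p q
    simp only [idTensor, kraus_apply, Matrix.of_apply, Matrix.sum_apply]
    refine Finset.sum_congr rfl fun k _ => ?_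
    simp [Matrix.mul_apply, Fintype.sum_prod_type, Matrix.one_apply, ite_mul,
      Finset.sum_ite_irrel, apply_ite]
  rw [h]
  exact posSemidef_sum _ fun k _ => hX.mul_mul_conjTranspose_same _

/-- The Choi matrix `∑ |x⟩⟨x'| ⊗ Φ(|x⟩⟨x'|)` of a linear map. -/
def choi [DecidableEq a] (Φ : SuperOp a b) : Matrix (a × b) (a × b) ℂ :=
  of fun p q => Φ (single p.1 q.1 1) p.2 q.2

theorem IsCP.choi_nonneg [Finite a] [DecidableEq a] {Φ : SuperOp a b} (h : IsCP Φ) :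
    0 ≤ choi Φ := by
  have := Fintype.ofFinite a
  let e := Fintype.equivFin a
  let v : Fin (Fintype.card a) × a → ℂ := fun p => if p.1 = e p.2 then 1 else 0
  have hv : choi Φ = (idTensor Φ (vecMulVec v (star v))).submatrix
      (fun p => (e p.1, p.2)) (fun p => (e p.1, p.2)) := by
    ext p q
    simp only [choi, idTensor, of_apply, submatrix_apply]
    refine congrFun₂ (congrArg Φ (Matrix.ext fun x x' => ?_)) _ _
    simp [v, vecMulVec_apply, single_apply, ← ite_and, and_comm]
  rw [hv]
  exact ((h _ _ (posSemidef_vecMulVec_self_star v)).submatrix _).nonneg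

theorem IsCP.exists_eq_kraus [Fintype a] [Fintype b] {Φ : SuperOp a b} (h : IsCP Φ) :
    ∃ K : a × b → Matrix b a ℂ, Φ = kraus K := by
  classical
  obtain ⟨B, hB⟩ := exists_eq_conjTranspose_mul_self h.choi_nonneg
  refine ⟨fun k => of fun y x => star (B k (x, y)), SuperOp.ext fun x x' y y' => ?_⟩
  rw [kraus_single_apply]
  simpa [Matrix.mul_apply, choi] using congrFun₂ hB (x, y) (x', y')

theorem IsCP.map_nonneg {Φ : SuperOp a b} (h : IsCP Φ)
    {X : Matrix a a ℂ} (hX : 0 ≤ X) : 0 ≤ Φ X := by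
  have hX' : (X.submatrix (fun p : Fin 1 × a => p.2) fun p => p.2).PosSemidef :=
    hX.posSemidef.submatrix _
  exact ((h 1 _ hX').submatrix fun y => (0, y)).nonneg

end KrausMaps

section Dual

variable {a b c κ : Type*}

/-- The adjoint of a superoperator for the trace pairing (the Heisenberg picture):
`tr (X · dual Φ Z) = tr (Φ X · Z)`. -/
def dual [DecidableEq a] [Fintype b] : SuperOp a b →ₗ[ℂ] SuperOp b a :=
  LinearMap.mk₂ ℂ (fun Φ Z => of fun x x' => (Φ (single x' x 1) * Z).trace)
    (fun _ _ _ => by ext; simp [add_mul]) (fun _ _ _ => by ext; simp)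
    (fun _ _ _ => by ext; simp [mul_add]) (fun _ _ _ => by ext; simp)

theorem dual_apply [DecidableEq a] [Fintype b] (Φ : SuperOp a b) (Z : Matrix b b ℂ) (x x' : a) :
    dual Φ Z x x' = (Φ (single x' x 1) * Z).trace := rfl

theorem trace_mul_dual [Fintype a] [DecidableEq a] [Fintype b] (Φ : SuperOp a b)
    (X : Matrix a a ℂ) (Z : Matrix b b ℂ) : (X * dual Φ Z).trace = (Φ X * Z).trace := by
  suffices h : traceLinearMap a ℂ ℂ ∘ₗ mulRightLinearMap a ℂ (dual Φ Z) =
      traceLinearMap b ℂ ℂ ∘ₗ mulRightLinearMap b ℂ Z ∘ₗ Φ from DFunLike.congr_fun h X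
  refine Matrix.ext_linearMap ℂ fun x x' => LinearMap.ext_ring ?_
  simp [trace_single_mul, dual_apply]

theorem eq_dual_of_trace_mul [Fintype a] [DecidableEq a] [Fintype b] {Φ : SuperOp a b}
    {Z : Matrix b b ℂ} {W : Matrix a a ℂ} (h : ∀ X, (X * W).trace = (Φ X * Z).trace) :
    W = dual Φ Z :=
  ext_iff_trace_mul_left.2 fun X => (h X).trans (trace_mul_dual Φ X Z).symm

theorem dual_comp [DecidableEq a] [Fintype b] [DecidableEq b] [Fintype c] (Ψ : SuperOp b c)
    (Φ : SuperOp a b) : dual (Ψ ∘ₗ Φ) = dual Φ ∘ₗ dual Ψ := by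
  ext1 Z
  ext x x'
  exact (trace_mul_dual Ψ _ Z).symm

theorem dual_dual [Fintype a] [DecidableEq a] [Fintype b] [DecidableEq b] (Φ : SuperOp a b) :
    dual (dual Φ) = Φ :=
  LinearMap.ext fun X => Eq.symm <| eq_dual_of_trace_mul fun Z => by
    rw [trace_mul_comm, ← trace_mul_dual, trace_mul_comm]

theorem dual_one_eq_one_iff [Fintype a] [DecidableEq a] [Fintype b] [DecidableEq b]
    {Φ : SuperOp a b} : dual Φ 1 = 1 ↔ ∀ X, (Φ X).trace = X.trace := by
  simp only [ext_iff_trace_mul_left, trace_mul_dual, Matrix.mul_one]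

theorem dual_kraus [Fintype a] [DecidableEq a] [Fintype b] [Fintype κ] (K : κ → Matrix b a ℂ) :
    dual (kraus K) = kraus fun k => (K k)ᴴ :=
  LinearMap.ext fun Z => Eq.symm <| eq_dual_of_trace_mul fun X => by
    simp only [kraus_apply, Matrix.mul_sum, Matrix.sum_mul, trace_sum, conjTranspose_conjTranspose]
    refine Finset.sum_congr rfl fun k _ => ?_
    rw [← Matrix.mul_assoc, trace_mul_comm, ← Matrix.mul_assoc, ← Matrix.mul_assoc]

theorem IsCP.dual [Finite a] [DecidableEq a] [Fintype b] {Φ : SuperOp a b} (h : IsCP Φ) :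
    IsCP (dual Φ) := by
  cases nonempty_fintype a
  obtain ⟨K, rfl⟩ := h.exists_eq_kraus
  exact dual_kraus K ▸ isCP_kraus _

end Dual

section States

variable {n c : Type*} [Fintype n] [Fintype c]

/-- The expectation `Re tr (σ X)` of the observable `X` in the state `σ`. -/
def State.expect (σ : State n) : Matrix n n ℂ →ₗ[ℝ] ℝ :=
  Complex.reLm ∘ₗ traceLinearMap n ℝ ℂ ∘ₗ LinearMap.mulLeft ℝ σ.1

theorem State.expect_apply (σ : State n) (X : Matrix n n ℂ) : σ.expect X = (σ.1 * X).trace.re :=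
  rfl

theorem State.expect_nonneg (σ : State n) {X : Matrix n n ℂ} (hX : 0 ≤ X) : 0 ≤ σ.expect X :=
  (Complex.le_def.1 (trace_mul_nonneg σ.2.1.nonneg hX)).1

theorem State.expect_mono (σ : State n) {X Y : Matrix n n ℂ} (h : X ≤ Y) :
    σ.expect X ≤ σ.expect Y := by
  rw [← sub_nonneg, ← map_sub]
  exact σ.expect_nonneg (sub_nonneg.2 h)

theorem State.expect_one [DecidableEq n] (σ : State n) : σ.expect 1 = 1 := by
  rw [State.expect_apply, Matrix.mul_one, σ.2.2, Complex.one_re]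

theorem exists_state_dotProduct_mulVec {v : n → ℂ} (hv : v ≠ 0) :
    ∃ σ : State n, ∀ A : Matrix n n ℂ,
      star v ⬝ᵥ A *ᵥ v = (star v ⬝ᵥ v) * (σ.1 * A).trace := by
  have hnonneg : 0 ≤ star v ⬝ᵥ v := dotProduct_star_self_nonneg v
  have hne : star v ⬝ᵥ v ≠ 0 := by simpa using hv
  refine ⟨⟨(star v ⬝ᵥ v)⁻¹ • vecMulVec v (star v), ?_, ?_⟩, fun A => ?_⟩
  · exact (posSemidef_vecMulVec_self_star v).smul (inv_nonneg.2 hnonneg)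
  · rw [trace_smul, trace_vecMulVec, dotProduct_comm v, smul_eq_mul, inv_mul_cancel₀ hne]
  · rw [Matrix.smul_mul, trace_smul, smul_eq_mul, mul_inv_cancel_left₀ hne, trace_mul_comm,
      mul_vecMulVec, trace_vecMulVec, dotProduct_comm]

theorem nonneg_of_forall_state {A : Matrix n n ℂ} (h : ∀ σ : State n, 0 ≤ (σ.1 * A).trace) :
    0 ≤ A := by
  refine nonneg_of_dotProduct_mulVec_nonneg fun v => ?_
  rcases eq_or_ne v 0 with rfl | hv
  · simp
  · obtain ⟨σ, hσ⟩ := exists_state_dotProduct_mulVec hv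
    exact hσ A ▸ mul_nonneg (dotProduct_star_self_nonneg v) (h σ)

theorem State.ofReal_expect (σ : State n) {X : Matrix n n ℂ} (hX : X.IsHermitian) :
    (σ.expect X : ℂ) = (σ.1 * X).trace := by
  rw [State.expect_apply, ← Complex.conj_eq_iff_re, starRingEnd_apply, ← trace_conjTranspose,
    conjTranspose_mul, hX.eq, σ.2.1.isHermitian.eq, trace_mul_comm]

theorem le_smul_one_of_forall_expect_le [DecidableEq n] {X : Matrix n n ℂ} (hX : X.IsHermitian)
    {t : ℝ} (h : ∀ σ : State n, σ.expect X ≤ t) : X ≤ t • (1 : Matrix n n ℂ) := by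
  refine sub_nonneg.1 (nonneg_of_forall_state fun σ => ?_)
  rw [mul_sub, trace_sub, ← σ.ofReal_expect hX, Matrix.mul_smul, trace_smul, Matrix.mul_one, σ.2.2,
    Complex.real_smul, mul_one, ← Complex.ofReal_sub, Complex.zero_le_real, sub_nonneg]
  exact h σ

/-- The pure state `|x⟩⟨x|` of a basis vector. -/
def State.basis [DecidableEq n] (x : n) : State n :=
  ⟨single x x 1, (single_self_nonneg x).posSemidef, by simp⟩

instance [Nonempty n] : Nonempty (State n) := by
  classical
  exact ⟨State.basis (Classical.arbitrary n)⟩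

/-- The image of a state under a channel. -/
def State.map {Φ : SuperOp n c} (hΦ : IsCPTP Φ) (ρ : State n) : State c :=
  ⟨Φ ρ.1, (IsCP.map_nonneg hΦ.completelyPositive ρ.2.1.nonneg).posSemidef,
    (hΦ.tracePreserving ρ.1).trans ρ.2.2⟩

end States

section Tensor

theorem trace_reindexLinearEquiv {m n : Type*} [Fintype m] [Fintype n] (e : m ≃ n)
    (X : Matrix m m ℂ) : (reindexLinearEquiv ℂ ℂ e e X).trace = X.trace :=
  e.symm.sum_comp fun x => X x x

/-- Operators on the tensor power `c^{⊗n}`. -/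
abbrev BlockOp (c : Type*) (n : ℕ) : Type _ := Matrix (Fin n → c) (Fin n → c) ℂ

variable {c : Type*} {m n : ℕ}

/-- The tensor product `X ⊗ Y` of operators on `c^{⊗m}` and `c^{⊗n}`, as an operator on
`c^{⊗(m+n)}`. -/
def tensor : BlockOp c m →ₗ[ℂ] BlockOp c n →ₗ[ℂ] BlockOp c (m + n) :=
  kroneckerBilinear.compr₂
    (reindexLinearEquiv ℂ ℂ (Fin.appendEquiv m n) (Fin.appendEquiv m n)).toLinearMap

theorem tensor_apply (X : BlockOp c m) (Y : BlockOp c n) :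
    tensor X Y = reindexLinearEquiv ℂ ℂ (Fin.appendEquiv m n) (Fin.appendEquiv m n) (X ⊗ₖ Y) :=
  rfl

theorem tensor_append (X : BlockOp c m) (Y : BlockOp c n) (x₁ x₁' : Fin m → c)
    (x₂ x₂' : Fin n → c) :
    tensor X Y (Fin.append x₁ x₂) (Fin.append x₁' x₂') = X x₁ x₁' * Y x₂ x₂' := by
  change (X ⊗ₖ Y) ((Fin.appendEquiv m n).symm (Fin.appendEquiv m n (x₁, x₂)))
    ((Fin.appendEquiv m n).symm (Fin.appendEquiv m n (x₁', x₂'))) = _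
  simp only [Equiv.symm_apply_apply, kronecker_apply]

theorem sum_append [Fintype c] {E : Type*} [AddCommMonoid E] (F : (Fin (m + n) → c) → E) :
    ∑ x, F x = ∑ x₁ : Fin m → c, ∑ x₂ : Fin n → c, F (Fin.append x₁ x₂) := by
  rw [← (Fin.appendEquiv m n).sum_comp, Fintype.sum_prod_type]
  rfl

theorem BlockOp.ext_append {X Y : BlockOp c (m + n)}
    (h : ∀ (x₁ x₁' : Fin m → c) (x₂ x₂' : Fin n → c),
      X (Fin.append x₁ x₂) (Fin.append x₁' x₂') = Y (Fin.append x₁ x₂) (Fin.append x₁' x₂')) :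
    X = Y := by
  ext x x'
  obtain ⟨⟨x₁, x₂⟩, rfl⟩ := (Fin.appendEquiv m n).surjective x
  obtain ⟨⟨x₁', x₂'⟩, rfl⟩ := (Fin.appendEquiv m n).surjective x'
  exact h x₁ x₁' x₂ x₂'

theorem trace_tensor [Fintype c] (X : BlockOp c m) (Y : BlockOp c n) :
    (tensor X Y).trace = X.trace * Y.trace := by
  rw [tensor_apply, trace_reindexLinearEquiv, trace_kronecker]

theorem tensor_mul_tensor [Fintype c] (X X' : BlockOp c m) (Y Y' : BlockOp c n) :
    tensor X Y * tensor X' Y' = tensor (X * X') (Y * Y') := by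
  rw [tensor_apply, tensor_apply, reindexLinearEquiv_mul, ← mul_kronecker_mul, tensor_apply]

theorem tensor_one_one [DecidableEq c] : tensor (1 : BlockOp c m) (1 : BlockOp c n) = 1 := by
  rw [tensor_apply, one_kronecker_one, reindexLinearEquiv_one]

theorem tensor_single_single [DecidableEq c] (x x' : Fin m → c) (y y' : Fin n → c) :
    tensor (single x x' 1) (single y y' 1) = single (Fin.append x y) (Fin.append x' y') 1 := by
  rw [tensor_apply, single_kronecker_single, mul_one, coe_reindexLinearEquiv, reindex_apply,
    submatrix_single_equiv]
  rfl

theorem tensor_nonneg [Finite c] {X : BlockOp c m} {Y : BlockOp c n} (hX : 0 ≤ X) (hY : 0 ≤ Y) :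
    0 ≤ tensor X Y :=
  ((hX.posSemidef.kronecker hY.posSemidef).submatrix (Fin.appendEquiv m n).symm).nonneg

theorem tensor_mono [Finite c] {X X' : BlockOp c m} {Y Y' : BlockOp c n} (hX : X ≤ X')
    (hY : Y ≤ Y') (hX' : 0 ≤ X') (hY₀ : 0 ≤ Y) : tensor X Y ≤ tensor X' Y' := by
  have hleft := tensor_nonneg (sub_nonneg.2 hX) hY₀
  have hright := tensor_nonneg hX' (sub_nonneg.2 hY)
  rw [map_sub, LinearMap.sub_apply, sub_nonneg] at hleft
  rw [map_sub, sub_nonneg] at hright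
  exact hleft.trans hright

theorem tensor_smul_one_one [DecidableEq c] (t : ℝ) :
    tensor (t • (1 : BlockOp c m)) (1 : BlockOp c n) = t • 1 := by
  rw [← Complex.coe_smul, map_smul, LinearMap.smul_apply, tensor_one_one, Complex.coe_smul]

theorem tensor_one_smul_one [DecidableEq c] (t : ℝ) :
    tensor (1 : BlockOp c m) (t • (1 : BlockOp c n)) = t • 1 := by
  rw [LinearMap.map_smul_of_tower, tensor_one_one]

theorem one_sub_tensor_le [Finite c] [DecidableEq c] {X : BlockOp c m} {Y : BlockOp c n} {e : ℝ}
    (hX : X ≤ 1) (hXe : 1 - X ≤ e • 1) (hY : Y ≤ 1) :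
    1 - tensor X Y ≤ e • 1 + tensor 1 (1 - Y) := by
  have hsplit : 1 - tensor X Y = tensor (1 - X) 1 + tensor X (1 - Y) := by
    simp only [map_sub, LinearMap.sub_apply, tensor_one_one]
    abel
  rw [hsplit, ← tensor_smul_one_one]
  exact add_le_add (tensor_mono hXe le_rfl ((sub_nonneg.2 hX).trans hXe) PosSemidef.one.nonneg)
    (tensor_mono hX le_rfl PosSemidef.one.nonneg (sub_nonneg.2 hY))

theorem isCP_reindex {a b : Type*} (e : a ≃ b) :
    IsCP (reindexLinearEquiv ℂ ℂ e e).toLinearMap :=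
  fun _ _ hX => hX.submatrix (Prod.map id e.symm)

theorem isCP_kronecker {a b : Type*} [Finite a] [Finite b] {ρ : Matrix a a ℂ} (hρ : 0 ≤ ρ) :
    IsCP (kroneckerBilinear ρ : SuperOp b (a × b)) :=
  fun k _ hX => (hρ.posSemidef.kronecker hX).submatrix
    fun p : Fin k × a × b => (p.2.1, (p.1, p.2.2))

theorem isCP_kronecker_flip {a b : Type*} [Finite a] [Finite b] {σ : Matrix b b ℂ} (hσ : 0 ≤ σ) :
    IsCP (kroneckerBilinear.flip σ : SuperOp a (a × b)) :=
  fun k _ hX => (hX.kronecker hσ.posSemidef).submatrix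
    fun p : Fin k × a × b => ((p.1, p.2.1), p.2.2)

theorem isCP_tensor [Finite c] {ρ : BlockOp c m} (hρ : 0 ≤ ρ) :
    IsCP (tensor ρ : SuperOp (Fin n → c) (Fin (m + n) → c)) :=
  (isCP_reindex (Fin.appendEquiv m n)).comp (isCP_kronecker hρ)

theorem dual_tensor {a b : Type*} [Fintype b] [DecidableEq a]
    {Ψ : SuperOp (Fin (m + n) → a) (Fin (m + n) → b)} {Φ₁ : SuperOp (Fin m → a) (Fin m → b)}
    {Φ₂ : SuperOp (Fin n → a) (Fin n → b)}
    (h : ∀ X Y, Ψ (tensor X Y) = tensor (Φ₁ X) (Φ₂ Y)) (Z : BlockOp b m) (W : BlockOp b n) :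
    dual Ψ (tensor Z W) = tensor (dual Φ₁ Z) (dual Φ₂ W) :=
  BlockOp.ext_append fun x₁ x₁' x₂ x₂' => by
    rw [tensor_append, dual_apply, ← tensor_single_single, h, tensor_mul_tensor, trace_tensor,
      dual_apply, dual_apply]

end Tensor

section TensorPower

variable {a b κ : Type*} [Fintype a] [DecidableEq a]

theorem tensorPow_single_apply (Φ : SuperOp a b) (ℓ : ℕ) (x x' : Fin ℓ → a) (y y' : Fin ℓ → b) :
    tensorPow Φ ℓ (single x x' 1) y y' = ∏ i, Φ (single (x i) (x' i) 1) (y i) (y' i) := by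
  simp [tensorPow, single_apply, ite_and]

theorem tensorPow_kraus [Fintype κ] (K : κ → Matrix b a ℂ) (ℓ : ℕ) :
    tensorPow (kraus K) ℓ = kraus fun k : Fin ℓ → κ => of fun y x => ∏ i, K (k i) (y i) (x i) :=
  SuperOp.ext fun x x' y y' => by
    classical
    simp only [tensorPow_single_apply, kraus_single_apply, of_apply, star_prod,
      ← Finset.prod_mul_distrib, Finset.prod_univ_sum, Fintype.piFinset_univ]

theorem IsCP.tensorPow [Finite b] {Φ : SuperOp a b} (h : IsCP Φ) (ℓ : ℕ) :
    IsCP (tensorPow Φ ℓ) := by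
  cases nonempty_fintype b
  obtain ⟨K, rfl⟩ := h.exists_eq_kraus
  exact tensorPow_kraus K ℓ ▸ isCP_kraus _

theorem trace_prod [Fintype b] {ℓ : ℕ} (X : Fin ℓ → Matrix b b ℂ) :
    (of fun y y' : Fin ℓ → b => ∏ i, X i (y i) (y' i)).trace = ∏ i, (X i).trace := by
  classical
  simp only [Matrix.trace, diag_apply, of_apply, Finset.prod_univ_sum, Fintype.piFinset_univ]

theorem trace_tensorPow [Fintype b] {Φ : SuperOp a b} (h : ∀ X, (Φ X).trace = X.trace) (ℓ : ℕ)
    (X : BlockOp a ℓ) : (tensorPow Φ ℓ X).trace = X.trace := by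
  suffices H : traceLinearMap _ ℂ ℂ ∘ₗ tensorPow Φ ℓ = traceLinearMap _ ℂ ℂ from
    DFunLike.congr_fun H X
  refine Matrix.ext_linearMap ℂ fun x x' => LinearMap.ext_ring ?_
  have hsingle : single x x' (1 : ℂ) =
      of fun z z' => ∏ i, single (x i) (x' i) (1 : ℂ) (z i) (z' i) := by
    ext z z'
    simp [single_apply, Finset.prod_ite_zero, funext_iff, forall_and]
  simp only [LinearMap.comp_apply, singleLinearMap_apply, traceLinearMap_apply]
  rw [hsingle, tensorPow_product, trace_prod, trace_prod]
  simp only [h]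

theorem tensorPow_tensor (Φ : SuperOp a b) {m n : ℕ} (X : BlockOp a m) (Y : BlockOp a n) :
    tensorPow Φ (m + n) (tensor X Y) = tensor (tensorPow Φ m X) (tensorPow Φ n Y) :=
  BlockOp.ext_append fun y₁ y₁' y₂ y₂' => by
    simp only [tensor_append, tensorPow, LinearMap.coe_mk, AddHom.coe_mk, of_apply, sum_append,
      Finset.sum_mul_sum, Fin.prod_univ_add, Fin.append_left, Fin.append_right]
    refine Finset.sum_congr rfl fun _ _ => Finset.sum_congr rfl fun _ _ =>
      Finset.sum_congr rfl fun _ _ => Finset.sum_congr rfl fun _ _ => ?_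
    ring

end TensorPower

section BlockChannel

variable {a j b : Type*} [Fintype a] [DecidableEq a] [Fintype j] [DecidableEq j]

theorem IsCP.blockChannel [Finite b] {N : SuperOp (a × j) b} (h : IsCP N) (ℓ : ℕ) :
    IsCP (blockChannel N ℓ) :=
  (h.tensorPow ℓ).comp (isCP_reindex _)

theorem trace_blockChannel [Fintype b] {N : SuperOp (a × j) b} (h : ∀ X, (N X).trace = X.trace)
    (ℓ : ℕ) (X : Matrix ((Fin ℓ → a) × (Fin ℓ → j)) ((Fin ℓ → a) × (Fin ℓ → j)) ℂ) :
    (blockChannel N ℓ X).trace = X.trace :=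
  (trace_tensorPow h ℓ _).trans (trace_reindexLinearEquiv _ X)

theorem blockChannel_tensor_kronecker_tensor (N : SuperOp (a × j) b) {m n : ℕ} (ρ₁ : BlockOp a m)
    (ρ₂ : BlockOp a n) (σ₁ : BlockOp j m) (σ₂ : BlockOp j n) :
    blockChannel N (m + n) (tensor ρ₁ ρ₂ ⊗ₖ tensor σ₁ σ₂) =
      tensor (blockChannel N m (ρ₁ ⊗ₖ σ₁)) (blockChannel N n (ρ₂ ⊗ₖ σ₂)) := by
  simp only [blockChannel, LinearMap.comp_apply, ← tensorPow_tensor]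
  congr 1
  ext x x'
  exact mul_mul_mul_comm _ _ _ _

theorem jammed_eq_comp (N : SuperOp (a × j) b) (ℓ : ℕ) (σ : State (Fin ℓ → j)) :
    jammed N ℓ σ = blockChannel N ℓ ∘ₗ kroneckerBilinear.flip σ.1 := rfl

theorem IsCP.jammed [Finite b] {N : SuperOp (a × j) b} (h : IsCP N) (ℓ : ℕ)
    (σ : State (Fin ℓ → j)) : IsCP (jammed N ℓ σ) := by
  rw [jammed_eq_comp]
  exact (IsCP.blockChannel h ℓ).comp (isCP_kronecker_flip σ.2.1.nonneg)

/-- The effect on the jammer's system which the input `ρ` and the effect `D` on the output induce: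
`tr (N^{⊗ℓ}(ρ ⊗ σ) D) = tr (σ · jammerEffect N ℓ ρ D)`. -/
def jammerEffect [Fintype b] (N : SuperOp (a × j) b) (ℓ : ℕ) :
    BlockOp a ℓ →ₗ[ℂ] BlockOp b ℓ →ₗ[ℂ] BlockOp j ℓ :=
  dual ∘ₗ LinearMap.compRight ℂ (blockChannel N ℓ) ∘ₗ kroneckerBilinear

variable [Fintype b] {N : SuperOp (a × j) b} {ℓ : ℕ}

theorem jammerEffect_apply (N : SuperOp (a × j) b) (ℓ : ℕ) (ρ : BlockOp a ℓ) :
    jammerEffect N ℓ ρ = dual (blockChannel N ℓ ∘ₗ kroneckerBilinear ρ) := rfl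

theorem trace_mul_jammerEffect (N : SuperOp (a × j) b) (ρ : BlockOp a ℓ) (D : BlockOp b ℓ)
    (σ : State (Fin ℓ → j)) :
    (σ.1 * jammerEffect N ℓ ρ D).trace = (jammed N ℓ σ ρ * D).trace := by
  rw [jammerEffect_apply, trace_mul_dual]
  rfl

theorem jammerEffect_nonneg (hN : IsCPTP N) {ρ : BlockOp a ℓ} {D : BlockOp b ℓ} (hρ : 0 ≤ ρ)
    (hD : 0 ≤ D) : 0 ≤ jammerEffect N ℓ ρ D :=
  ((IsCP.blockChannel hN.completelyPositive ℓ).comp (isCP_kronecker hρ)).dual.map_nonneg hD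

theorem jammerEffect_tensor (N : SuperOp (a × j) b) {m n : ℕ} (ρ₁ : BlockOp a m)
    (ρ₂ : BlockOp a n) (D₁ : BlockOp b m) (D₂ : BlockOp b n) :
    jammerEffect N (m + n) (tensor ρ₁ ρ₂) (tensor D₁ D₂) =
      tensor (jammerEffect N m ρ₁ D₁) (jammerEffect N n ρ₂ D₂) :=
  dual_tensor (blockChannel_tensor_kronecker_tensor N ρ₁ ρ₂) D₁ D₂

theorem jammerEffect_mono (hN : IsCPTP N) {ρ : BlockOp a ℓ} {D D' : BlockOp b ℓ} (hρ : 0 ≤ ρ)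
    (hD : D ≤ D') : jammerEffect N ℓ ρ D ≤ jammerEffect N ℓ ρ D' := by
  rw [← sub_nonneg, ← map_sub]
  exact jammerEffect_nonneg hN hρ (sub_nonneg.2 hD)

variable [DecidableEq b]

theorem jammerEffect_one (hN : IsCPTP N) (ρ : State (Fin ℓ → a)) :
    jammerEffect N ℓ ρ.1 1 = 1 := by
  refine dual_one_eq_one_iff.2 fun σ => (trace_blockChannel hN.tracePreserving ℓ _).trans ?_
  exact (trace_kronecker _ _).trans (by rw [ρ.2.2, one_mul])

theorem jammerEffect_one_sub (hN : IsCPTP N) (ρ : State (Fin ℓ → a)) (D : BlockOp b ℓ) :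
    jammerEffect N ℓ ρ.1 (1 - D) = 1 - jammerEffect N ℓ ρ.1 D := by
  rw [map_sub, jammerEffect_one hN]

theorem jammerEffect_le_one (hN : IsCPTP N) (ρ : State (Fin ℓ → a)) {D : BlockOp b ℓ}
    (hD : D ≤ 1) : jammerEffect N ℓ ρ.1 D ≤ 1 :=
  (jammerEffect_mono hN ρ.2.1.nonneg hD).trans_eq (jammerEffect_one hN ρ)

end BlockChannel

section Expect

variable {ι R V W : Type*}

theorem linearMap_expect [Semiring R] [AddCommMonoid V] [AddCommMonoid W] [Module R V] [Module R W]
    [Module ℚ≥0 V] [Module ℚ≥0 W] [LinearMap.CompatibleSMul V W ℚ≥0 R] (f : V →ₗ[R] W)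
    (s : Finset ι) (v : ι → V) : f (𝔼 i ∈ s, v i) = 𝔼 i ∈ s, f (v i) :=
  map_expect (f.restrictScalars ℚ≥0) v s

theorem expect_le_of_nonneg {M : Type*} [AddCommMonoid M] [PartialOrder M] [IsOrderedAddMonoid M]
    [Module ℚ≥0 M] [PosSMulMono ℚ≥0 M] {s : Finset ι} {f : ι → M} {a : M} (ha : 0 ≤ a)
    (h : ∀ i ∈ s, f i ≤ a) : 𝔼 i ∈ s, f i ≤ a := by
  rcases s.eq_empty_or_nonempty with rfl | hs
  · rwa [Finset.expect_empty]
  · exact Finset.expect_le hs h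

theorem expect_le_nsmul_expect_univ {M : Type*} [AddCommMonoid M] [PartialOrder M]
    [IsOrderedAddMonoid M] [Module ℚ≥0 M] [PosSMulMono ℚ≥0 M] [Fintype ι] {f : ι → M}
    (hf : ∀ i, 0 ≤ f i) {s : Finset ι} (hs : s.Nonempty) {c : ℕ}
    (hc : Fintype.card ι ≤ c * s.card) : 𝔼 i ∈ s, f i ≤ c • 𝔼 i, f i := by
  have hsum : ∑ i ∈ s, f i ≤ s.card • c • 𝔼 i, f i := calc
    ∑ i ∈ s, f i ≤ ∑ i, f i := Finset.sum_le_univ_sum_of_nonneg hf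
    _ = Fintype.card ι • 𝔼 i, f i := (Finset.card_smul_expect _ _).symm
    _ ≤ (c * s.card) • 𝔼 i, f i :=
      nsmul_le_nsmul_left (Finset.expect_nonneg fun i _ => hf i) hc
    _ = s.card • c • 𝔼 i, f i := by rw [mul_comm, mul_smul]
  have hcard : (s.card : ℚ≥0) ≠ 0 := Nat.cast_ne_zero.2 hs.card_ne_zero
  calc 𝔼 i ∈ s, f i = (s.card : ℚ≥0)⁻¹ • ∑ i ∈ s, f i := rfl
    _ ≤ (s.card : ℚ≥0)⁻¹ • s.card • c • 𝔼 i, f i :=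
      smul_le_smul_of_nonneg_left hsum (by positivity)
    _ = c • 𝔼 i, f i := by
      rw [← Nat.cast_smul_eq_nsmul ℚ≥0 s.card, inv_smul_smul₀ hcard]

/-- The uniform mixture of a nonempty finite family of states. -/
def State.avg {n : Type*} [Fintype n] (s : Finset ι) (hs : s.Nonempty) (ρ : ι → State n) :
    State n :=
  ⟨𝔼 i ∈ s, (ρ i).1, (Finset.expect_nonneg fun i _ => (ρ i).2.1.nonneg).posSemidef, by
    rw [← traceLinearMap_apply n ℂ ℂ, linearMap_expect]
    simp only [traceLinearMap_apply, (ρ _).2.2, Finset.expect_const hs]⟩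

theorem jammerEffect_expect {a j b ι : Type*} [Fintype a] [DecidableEq a] [Fintype j]
    [DecidableEq j] [Fintype b] {ℓ : ℕ} (N : SuperOp (a × j) b) (s : Finset ι)
    (ρ : ι → BlockOp a ℓ) (D : BlockOp b ℓ) :
    jammerEffect N ℓ (𝔼 i ∈ s, ρ i) D = 𝔼 i ∈ s, jammerEffect N ℓ (ρ i) D :=
  linearMap_expect ((jammerEffect N ℓ).flip D) s ρ

end Expect

theorem ClassicalCode.D_nonneg {a b : Type*} [Fintype a] [Fintype b] [DecidableEq b] {ℓ M : ℕ}
    (C : ClassicalCode a b ℓ M) (i : Fin M) : 0 ≤ C.D i :=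
  (C.posSemidef i).nonneg

theorem ClassicalCode.D_le_one {a b : Type*} [Fintype a] [Fintype b] [DecidableEq b] {ℓ M : ℕ}
    (C : ClassicalCode a b ℓ M) (i : Fin M) : C.D i ≤ 1 :=
  (Finset.single_le_sum (fun i _ => C.D_nonneg i) (Finset.mem_univ i)).trans_eq C.sum_eq_one

/-- The classical code with a single message, which is sent as `ρ`. -/
def ClassicalCode.trivial {a b : Type*} [Fintype a] [Fintype b] [DecidableEq b] {ℓ : ℕ}
    (ρ : State (Fin ℓ → a)) : ClassicalCode a b ℓ 1 where
  ρ _ := ρ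
  D _ := 1
  posSemidef _ := PosSemidef.one
  sum_eq_one := Fin.sum_univ_one _

section Tests

variable {a j b : Type*} [Fintype a] [DecidableEq a] [Fintype j] [DecidableEq j] [Fintype b]
  [DecidableEq b] {N : SuperOp (a × j) b} {ℓ m n : ℕ} {e e₀ e₁ : ℝ}

/-- The product of two states. -/
def State.tensor {c : Type*} [Fintype c] (ρ : State (Fin m → c)) (τ : State (Fin n → c)) :
    State (Fin (m + n) → c) :=
  ⟨QAVC.tensor ρ.1 τ.1, (tensor_nonneg ρ.2.1.nonneg τ.2.1.nonneg).posSemidef, by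
    rw [trace_tensor, ρ.2.2, τ.2.2, one_mul]⟩

theorem jammerEffect_one_sub_tensor_le (hN : IsCPTP N) {ρ : State (Fin m → a)}
    {τ : State (Fin n → a)} {D : BlockOp b m} {D' : BlockOp b n} (hD : D ≤ 1) (hD' : D' ≤ 1)
    (he : jammerEffect N m ρ.1 (1 - D) ≤ e • 1) :
    jammerEffect N (m + n) (tensor ρ.1 τ.1) (1 - tensor D D') ≤
      e • 1 + tensor 1 (jammerEffect N n τ.1 (1 - D')) := by
  have hsub : jammerEffect N (m + n) (tensor ρ.1 τ.1) (1 - tensor D D') =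
      1 - tensor (jammerEffect N m ρ.1 D) (jammerEffect N n τ.1 D') := by
    rw [← jammerEffect_tensor]
    exact jammerEffect_one_sub hN (ρ.tensor τ) _
  rw [hsub, jammerEffect_one_sub hN]
  rw [jammerEffect_one_sub hN] at he
  exact one_sub_tensor_le (jammerEffect_le_one hN ρ hD) he (jammerEffect_le_one hN τ hD')

theorem jammerEffect_one_sub_tensor_le_add (hN : IsCPTP N) {ρ : State (Fin m → a)}
    {τ : State (Fin n → a)} {D : BlockOp b m} {D' : BlockOp b n} (hD : D ≤ 1) (hD' : D' ≤ 1)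
    (he₀ : jammerEffect N m ρ.1 (1 - D) ≤ e₀ • 1) (he₁ : jammerEffect N n τ.1 (1 - D') ≤ e₁ • 1) :
    jammerEffect N (m + n) (tensor ρ.1 τ.1) (1 - tensor D D') ≤ (e₀ + e₁) • 1 := by
  refine (jammerEffect_one_sub_tensor_le hN hD hD' he₀).trans ?_
  rw [add_smul, ← tensor_one_smul_one (m := m) (n := n) e₁]
  exact add_le_add le_rfl (tensor_mono le_rfl he₁ PosSemidef.one.nonneg
    (jammerEffect_nonneg hN τ.2.1.nonneg (sub_nonneg.2 hD')))

/-- There is a pair of signal states of block length `ℓ` and a test which, against every jammer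
state, confuses the first with the second with probability at most `e₀` and the second with the
first with probability at most `e₁`. -/
def HasTest (N : SuperOp (a × j) b) (ℓ : ℕ) (e₀ e₁ : ℝ) : Prop :=
  ∃ (ρ₀ ρ₁ : State (Fin ℓ → a)) (D : BlockOp b ℓ), 0 ≤ D ∧ D ≤ 1 ∧
    jammerEffect N ℓ ρ₀.1 D ≤ e₀ • 1 ∧ jammerEffect N ℓ ρ₁.1 (1 - D) ≤ e₁ • 1

theorem HasTest.swap (h : HasTest N ℓ e₀ e₁) : HasTest N ℓ e₁ e₀ := by
  obtain ⟨ρ₀, ρ₁, D, hD₀, hD₁, h₀, h₁⟩ := h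
  exact ⟨ρ₁, ρ₀, 1 - D, sub_nonneg.2 hD₁, sub_le_self _ hD₀, h₁, by rwa [sub_sub_cancel]⟩

theorem HasTest.mono {e₀' e₁' : ℝ} (h : HasTest N ℓ e₀ e₁) (he₀ : e₀ ≤ e₀') (he₁ : e₁ ≤ e₁') :
    HasTest N ℓ e₀' e₁' := by
  obtain ⟨ρ₀, ρ₁, D, hD₀, hD₁, h₀, h₁⟩ := h
  exact ⟨ρ₀, ρ₁, D, hD₀, hD₁,
    h₀.trans (smul_le_smul_of_nonneg_right he₀ PosSemidef.one.nonneg),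
    h₁.trans (smul_le_smul_of_nonneg_right he₁ PosSemidef.one.nonneg)⟩

theorem HasTest.double (hN : IsCPTP N) (he : 0 ≤ e₀) (h : HasTest N ℓ e₀ e₁) :
    HasTest N (ℓ + ℓ) (e₀ ^ 2) (2 * e₁) := by
  obtain ⟨ρ₀, ρ₁, D, hD₀, hD₁, h₀, h₁⟩ := h
  refine ⟨ρ₀.tensor ρ₀, ρ₁.tensor ρ₁, tensor D D, tensor_nonneg hD₀ hD₀, ?_, ?_, ?_⟩
  · rw [← tensor_one_one]
    exact tensor_mono hD₁ hD₁ PosSemidef.one.nonneg hD₀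
  · calc jammerEffect N (ℓ + ℓ) (tensor ρ₀.1 ρ₀.1) (tensor D D)
        = tensor (jammerEffect N ℓ ρ₀.1 D) (jammerEffect N ℓ ρ₀.1 D) := jammerEffect_tensor ..
      _ ≤ tensor (e₀ • 1) (e₀ • 1) := tensor_mono h₀ h₀ (smul_nonneg he PosSemidef.one.nonneg)
          (jammerEffect_nonneg hN ρ₀.2.1.nonneg hD₀)
      _ = e₀ ^ 2 • 1 := by
          rw [LinearMap.map_smul_of_tower, tensor_smul_one_one, smul_smul, sq]
  · rw [two_mul]
    exact jammerEffect_one_sub_tensor_le_add hN hD₁ hD₁ h₁ h₁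

-- Doubling twice, with the roles of the two errors exchanged in between, turns the pair `(e, e)`
-- into `(4 e², 4 e²)`, so it squares `4 e`.
theorem HasTest.amplify (hN : IsCPTP N) (he : 0 ≤ e) (h : HasTest N ℓ e e) (r : ℕ) :
    HasTest N (4 ^ r * ℓ) ((4 * e) ^ 2 ^ r / 4) ((4 * e) ^ 2 ^ r / 4) := by
  induction r with
  | zero => simpa using h
  | succ r ih =>
    have hlength : 4 ^ (r + 1) * ℓ = (4 ^ r * ℓ + 4 ^ r * ℓ) + (4 ^ r * ℓ + 4 ^ r * ℓ) := by ring
    have hsquare : (4 * e) ^ 2 ^ (r + 1) = ((4 * e) ^ 2 ^ r) ^ 2 := by rw [← pow_mul, pow_succ]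
    rw [hlength, hsquare]
    refine ((ih.double hN (by positivity)).swap.double hN (by positivity)).mono ?_ ?_ <;>
      nlinarith [sq_nonneg ((4 * e) ^ 2 ^ r)]

/-- There is a classical code with `K` messages of block length `ℓ` whose maximal error probability
is at most `e`, against every jammer state. -/
def HasCode (N : SuperOp (a × j) b) (ℓ K : ℕ) (e : ℝ) : Prop :=
  ∃ C : ClassicalCode a b ℓ K, ∀ k, jammerEffect N ℓ (C.ρ k).1 (1 - C.D k) ≤ e • 1

theorem HasTest.hasCode (h : HasTest N ℓ e e) : HasCode N ℓ 2 e := by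
  obtain ⟨ρ₀, ρ₁, D, hD₀, hD₁, h₀, h₁⟩ := h
  refine ⟨⟨![ρ₀, ρ₁], ![1 - D, D], Fin.forall_fin_two.2 ?_, by simp⟩, Fin.forall_fin_two.2 ?_⟩
  · exact ⟨(sub_nonneg.2 hD₁).posSemidef, hD₀.posSemidef⟩
  · exact ⟨by simpa using h₀, by simpa using h₁⟩

theorem hasCode_one [Nonempty a] (N : SuperOp (a × j) b) (ℓ : ℕ) : HasCode N ℓ 1 0 :=
  ⟨ClassicalCode.trivial (Classical.arbitrary _), by simp [ClassicalCode.trivial]⟩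

theorem HasCode.mul (hN : IsCPTP N) {K K' : ℕ} (h : HasCode N m K e₀) (h' : HasCode N n K' e₁) :
    HasCode N (m + n) (K * K') (e₀ + e₁) := by
  obtain ⟨C, hC⟩ := h
  obtain ⟨C', hC'⟩ := h'
  let f := (finProdFinEquiv (m := K) (n := K')).symm
  refine ⟨⟨fun k => (C.ρ (f k).1).tensor (C'.ρ (f k).2),
    fun k => tensor (C.D (f k).1) (C'.D (f k).2),
    fun k => (tensor_nonneg (C.D_nonneg _) (C'.D_nonneg _)).posSemidef, ?_⟩, fun k => ?_⟩
  · rw [f.sum_comp (fun p => tensor (C.D p.1) (C'.D p.2)), Fintype.sum_prod_type]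
    simp only [← map_sum, C'.sum_eq_one]
    rw [← LinearMap.sum_apply, ← map_sum, C.sum_eq_one, tensor_one_one]
  · exact jammerEffect_one_sub_tensor_le_add hN (C.D_le_one _) (C'.D_le_one _) (hC _) (hC' _)

theorem HasCode.pow [Nonempty a] (hN : IsCPTP N) {K : ℕ} (h : HasCode N ℓ K e) (B : ℕ) :
    HasCode N (B * ℓ) (K ^ B) (B * e) := by
  induction B with
  | zero => simpa using hasCode_one N _
  | succ B ih =>
    rw [Nat.succ_mul, pow_succ, Nat.cast_succ, add_mul, one_mul]
    exact ih.mul hN h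

end Tests

section Classical

variable {a j b : Type*} [Fintype a] [DecidableEq a] [Fintype j] [DecidableEq j] [Fintype b]
  [DecidableEq b] {N : SuperOp (a × j) b} {ℓ M : ℕ}

/-- The error operator of a classical code: its expectation in a jammer state is the error
probability. -/
def ClassicalCode.errOp (C : ClassicalCode a b ℓ M) (N : SuperOp (a × j) b) : BlockOp j ℓ :=
  𝔼 i, jammerEffect N ℓ (C.ρ i).1 (1 - C.D i)

theorem ClassicalCode.err_eq_expect (C : ClassicalCode a b ℓ M) (N : SuperOp (a × j) b)
    (σ : State (Fin ℓ → j)) : C.err N σ = σ.expect (C.errOp N) := by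
  rw [ClassicalCode.errOp, linearMap_expect, Fintype.expect_eq_sum_div_card, Fintype.card_fin]
  simp only [State.expect_apply, trace_mul_jammerEffect]
  rw [ClassicalCode.err, one_div_mul_eq_div]

theorem ClassicalCode.errOp_trivial (N : SuperOp (a × j) b) (ρ : State (Fin ℓ → a)) :
    (ClassicalCode.trivial ρ : ClassicalCode a b ℓ 1).errOp N = 0 := by
  simp [ClassicalCode.errOp, ClassicalCode.trivial]

theorem ClassicalCode.errOp_nonneg (hN : IsCPTP N) (C : ClassicalCode a b ℓ M) : 0 ≤ C.errOp N :=
  Finset.expect_nonneg fun i _ =>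
    jammerEffect_nonneg hN (C.ρ i).2.1.nonneg (sub_nonneg.2 (C.D_le_one i))

theorem ClassicalCode.errOp_le_one (hN : IsCPTP N) (C : ClassicalCode a b ℓ M) : C.errOp N ≤ 1 :=
  expect_le_of_nonneg PosSemidef.one.nonneg fun i _ =>
    jammerEffect_le_one hN (C.ρ i) (sub_le_self _ (C.D_nonneg i))

theorem ClassicalCode.jammerEffect_avg_le (hN : IsCPTP N) (C : ClassicalCode a b ℓ M)
    {s : Finset (Fin M)} (hs : s.Nonempty) (hM : M ≤ 3 * s.card) :
    jammerEffect N ℓ (State.avg s hs C.ρ).1 (1 - ∑ i ∈ s, C.D i) ≤ 3 • C.errOp N := by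
  have hmono : ∀ i ∈ s, jammerEffect N ℓ (C.ρ i).1 (1 - ∑ i ∈ s, C.D i) ≤
      jammerEffect N ℓ (C.ρ i).1 (1 - C.D i) := fun i hi =>
    jammerEffect_mono hN (C.ρ i).2.1.nonneg
      (sub_le_sub_left (Finset.single_le_sum (fun i _ => C.D_nonneg i) hi) _)
  calc jammerEffect N ℓ (State.avg s hs C.ρ).1 (1 - ∑ i ∈ s, C.D i)
      = 𝔼 i ∈ s, jammerEffect N ℓ (C.ρ i).1 (1 - ∑ i ∈ s, C.D i) := jammerEffect_expect ..
    _ ≤ 𝔼 i ∈ s, jammerEffect N ℓ (C.ρ i).1 (1 - C.D i) := Finset.expect_le_expect hmono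
    _ ≤ 3 • C.errOp N := expect_le_nsmul_expect_univ
        (fun i => jammerEffect_nonneg hN (C.ρ i).2.1.nonneg (sub_nonneg.2 (C.D_le_one i))) hs
        (by rwa [Fintype.card_fin])

theorem ClassicalCode.hasTest (hN : IsCPTP N) (C : ClassicalCode a b ℓ M) (hM : 2 ≤ M) {ε : ℝ}
    (h : C.errOp N ≤ ε • 1) : HasTest N ℓ (3 * ε) (3 * ε) := by
  let s : Finset (Fin M) := Finset.univ.filter fun i => (i : ℕ) < M / 2
  have hcard : s.card = M / 2 := by
    rw [Fin.card_filter_val_lt]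
    omega
  have hcard' : sᶜ.card = M - M / 2 := by rw [Finset.card_compl, hcard, Fintype.card_fin]
  have hs : s.Nonempty := Finset.card_pos.1 (by omega)
  have hs' : sᶜ.Nonempty := Finset.card_pos.1 (by omega)
  have hsum : 1 - ∑ i ∈ sᶜ, C.D i = ∑ i ∈ s, C.D i := by
    rw [← C.sum_eq_one, sub_eq_iff_eq_add, Finset.sum_add_sum_compl]
  have h3 : 3 • C.errOp N ≤ (3 * ε) • 1 := by
    rw [mul_smul, ← Nat.cast_smul_eq_nsmul ℝ]
    exact smul_le_smul_of_nonneg_left h (by norm_num)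
  have hD : 0 ≤ ∑ i ∈ s, C.D i := Finset.sum_nonneg fun i _ => C.D_nonneg i
  refine ⟨State.avg sᶜ hs' C.ρ, State.avg s hs C.ρ, ∑ i ∈ s, C.D i, hD, ?_, ?_, ?_⟩
  · rw [← hsum]
    exact sub_le_self _ (Finset.sum_nonneg fun i _ => C.D_nonneg i)
  · rw [← hsum]
    exact (C.jammerEffect_avg_le hN hs' (by omega)).trans h3
  · exact (C.jammerEffect_avg_le hN hs (by omega)).trans h3

/-- The code which first sends a uniformly random index `k` with the code `C` and then uses the code
`C' k`. -/
def ClassicalCode.concat {m n K : ℕ} [NeZero K] (C : ClassicalCode a b m K)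
    (C' : Fin K → ClassicalCode a b n M) : ClassicalCode a b (m + n) M where
  ρ i := State.avg Finset.univ Finset.univ_nonempty fun k => (C.ρ k).tensor ((C' k).ρ i)
  D i := ∑ k, tensor (C.D k) ((C' k).D i)
  posSemidef i := posSemidef_sum _ fun k _ =>
    (tensor_nonneg (C.D_nonneg k) ((C' k).D_nonneg i)).posSemidef
  sum_eq_one := by
    rw [Finset.sum_comm]
    simp only [← map_sum, (C' _).sum_eq_one]
    rw [← LinearMap.sum_apply, ← map_sum, C.sum_eq_one, tensor_one_one]

theorem ClassicalCode.jammerEffect_concat_le (hN : IsCPTP N) {m n K : ℕ} [NeZero K] {e : ℝ}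
    {C : ClassicalCode a b m K} (hC : ∀ k, jammerEffect N m (C.ρ k).1 (1 - C.D k) ≤ e • 1)
    (C' : Fin K → ClassicalCode a b n M) (i : Fin M) :
    jammerEffect N (m + n) ((C.concat C').ρ i).1 (1 - (C.concat C').D i) ≤
      e • 1 + tensor 1 (𝔼 k, jammerEffect N n ((C' k).ρ i).1 (1 - (C' k).D i)) := by
  have hk : ∀ k, jammerEffect N (m + n) ((C.ρ k).tensor ((C' k).ρ i)).1 (1 - (C.concat C').D i) ≤
      e • 1 + tensor 1 (jammerEffect N n ((C' k).ρ i).1 (1 - (C' k).D i)) := fun k => by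
    have hD : tensor (C.D k) ((C' k).D i) ≤ (C.concat C').D i :=
      Finset.single_le_sum (f := fun k => tensor (C.D k) ((C' k).D i))
        (fun k _ => tensor_nonneg (C.D_nonneg k) ((C' k).D_nonneg i)) (Finset.mem_univ k)
    exact (jammerEffect_mono hN ((C.ρ k).tensor _).2.1.nonneg (sub_le_sub_left hD _)).trans
      (jammerEffect_one_sub_tensor_le hN (C.D_le_one k) ((C' k).D_le_one i) (hC k))
  calc jammerEffect N (m + n) ((C.concat C').ρ i).1 (1 - (C.concat C').D i)
      = 𝔼 k, jammerEffect N (m + n) ((C.ρ k).tensor ((C' k).ρ i)).1 (1 - (C.concat C').D i) :=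
        jammerEffect_expect ..
    _ ≤ 𝔼 k, (e • 1 + tensor 1 (jammerEffect N n ((C' k).ρ i).1 (1 - (C' k).D i))) :=
        Finset.expect_le_expect fun k _ => hk k
    _ = e • 1 + tensor 1 (𝔼 k, jammerEffect N n ((C' k).ρ i).1 (1 - (C' k).D i)) := by
        rw [Finset.expect_add_distrib, Fintype.expect_const, linearMap_expect]

theorem ClassicalCode.exists_concat (hN : IsCPTP N) {m n K : ℕ} [NeZero K] {e : ℝ} (he : 0 ≤ e)
    (hC : HasCode N m K e) (C' : Fin K → ClassicalCode a b n M) :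
    ∃ C'' : ClassicalCode a b (m + n) M,
      C''.errOp N ≤ e • 1 + tensor 1 (𝔼 k, (C' k).errOp N) := by
  obtain ⟨C, hC⟩ := hC
  refine ⟨C.concat C',
    (Finset.expect_le_expect fun i _ => ClassicalCode.jammerEffect_concat_le hN hC C' i).trans ?_⟩
  rw [Finset.expect_add_distrib, ← linearMap_expect, Finset.expect_comm]
  exact add_le_add
    (expect_le_of_nonneg (smul_nonneg he PosSemidef.one.nonneg) fun _ _ => le_rfl) le_rfl

end Classical

section CompletelyPositiveSums

variable {a b ι : Type*}

theorem IsCP.sum {s : Finset ι} {Φ : ι → SuperOp a b} (h : ∀ i ∈ s, IsCP (Φ i)) :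
    IsCP (∑ i ∈ s, Φ i) := fun k X hX => by
  have hsum : idTensor (∑ i ∈ s, Φ i) X = ∑ i ∈ s, idTensor (Φ i) X := by
    ext
    simp [idTensor, Matrix.sum_apply]
  exact hsum ▸ posSemidef_sum s fun i hi => h i hi k X hX

theorem IsCP.smul {Φ : SuperOp a b} (h : IsCP Φ) {t : ℂ} (ht : 0 ≤ t) : IsCP (t • Φ) :=
  fun k X hX => (h k X hX).smul ht

theorem IsCP.expect {s : Finset ι} {Φ : ι → SuperOp a b} (h : ∀ i ∈ s, IsCP (Φ i)) :
    IsCP (𝔼 i ∈ s, Φ i) := by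
  rw [Finset.expect, ← NNRat.cast_smul_eq_nnqsmul ℂ]
  refine (IsCP.sum h).smul ?_
  rw [NNRat.cast_inv, NNRat.cast_natCast]
  exact inv_nonneg.2 (Nat.cast_nonneg _)

end CompletelyPositiveSums

section Fidelity

variable {a j b l : Type*} [Fintype a] [DecidableEq a] [Fintype j] [DecidableEq j] [Fintype b]
  [DecidableEq b] [Fintype l] {N : SuperOp (a × j) b} {ℓ L : ℕ}

theorem expect_entries_nonneg {S : Matrix l l ℂ} (hS : 0 ≤ S) : 0 ≤ 𝔼 i, 𝔼 i', S i i' := by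
  have hsum : 0 ≤ ∑ i, ∑ i', S i i' := by
    simpa [dotProduct, mulVec] using hS.posSemidef.dotProduct_mulVec_nonneg 1
  simp only [Fintype.expect_eq_sum_div_card, ← Finset.sum_div]
  positivity

theorem expect_entries_le_expect_diag {S : Matrix l l ℂ} (hS : 0 ≤ S) :
    𝔼 i, 𝔼 i', S i i' ≤ 𝔼 i, S i i := by
  classical
  cases isEmpty_or_nonempty l
  · simp
  have hpair : ∀ i i', 0 ≤ S i i + S i' i' - S i i' - S i' i := fun i i' => by
    have h := hS.posSemidef.dotProduct_mulVec_nonneg (Pi.single i 1 - Pi.single i' 1)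
    simp only [mulVec_sub, mulVec_single_one, star_sub, Pi.star_single, star_one, sub_dotProduct,
      dotProduct_sub, single_one_dotProduct, Matrix.col_apply] at h
    convert h using 1
    ring
  have hmean : 0 ≤ 𝔼 i, 𝔼 i', (S i i + S i' i' - S i i' - S i' i) :=
    Finset.expect_nonneg fun i _ => Finset.expect_nonneg fun i' _ => hpair i i'
  have htwice : 𝔼 i, 𝔼 i', (S i i + S i' i' - S i i' - S i' i) =
      (2 : ℝ) • (𝔼 i, S i i - 𝔼 i, 𝔼 i', S i i') := by
    simp only [Finset.expect_sub_distrib, Finset.expect_add_distrib, Fintype.expect_const]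
    rw [Finset.expect_comm (f := fun i i' => S i' i), two_smul]
    ring
  exact sub_nonneg.1 ((smul_nonneg_iff_nonneg_of_pos_left two_pos).1 (hmean.trans_eq htwice))

variable [DecidableEq l]

/-- The operator on `J^ℓ` whose expectation in a jammer state is the entanglement fidelity of the
encoder `E` and the decoder `D`. -/
def fidOp (N : SuperOp (a × j) b) (ℓ : ℕ) :
    SuperOp l (Fin ℓ → a) →ₗ[ℂ] SuperOp (Fin ℓ → b) l →ₗ[ℂ] BlockOp j ℓ :=
  LinearMap.mk₂ ℂ
    (fun E D => 𝔼 i, 𝔼 i', jammerEffect N ℓ (E (single i i' 1)) (dual D (single i' i 1)))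
    (fun _ _ _ => by simp [Finset.expect_add_distrib])
    (fun _ _ _ => by simp [Finset.smul_expect])
    (fun _ _ _ => by simp [Finset.expect_add_distrib])
    (fun _ _ _ => by simp [Finset.smul_expect])

theorem fidOp_apply (N : SuperOp (a × j) b) (E : SuperOp l (Fin ℓ → a))
    (D : SuperOp (Fin ℓ → b) l) : fidOp N ℓ E D =
      𝔼 i, 𝔼 i', jammerEffect N ℓ (E (single i i' 1)) (dual D (single i' i 1)) := rfl

theorem trace_mul_jammerEffect_dual (N : SuperOp (a × j) b) (E : SuperOp l (Fin ℓ → a))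
    (D : SuperOp (Fin ℓ → b) l) (σ : State (Fin ℓ → j)) (i i' : l) :
    (σ.1 * jammerEffect N ℓ (E (single i i' 1)) (dual D (single i' i 1))).trace =
      choi (D ∘ₗ jammed N ℓ σ ∘ₗ E) (i, i) (i', i') := by
  rw [trace_mul_jammerEffect, trace_mul_dual, trace_mul_single, MulOpposite.op_one,
    one_smul]
  rfl

theorem trace_mul_expect {n ι : Type*} [Fintype n] (A : Matrix n n ℂ) (s : Finset ι)
    (X : ι → Matrix n n ℂ) : (A * 𝔼 i ∈ s, X i).trace = 𝔼 i ∈ s, (A * X i).trace :=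
  linearMap_expect (traceLinearMap n ℂ ℂ ∘ₗ mulLeftLinearMap n ℂ A) s X

theorem trace_mul_fidOp (N : SuperOp (a × j) b) (E : SuperOp l (Fin ℓ → a))
    (D : SuperOp (Fin ℓ → b) l) (σ : State (Fin ℓ → j)) :
    (σ.1 * fidOp N ℓ E D).trace =
      𝔼 i, 𝔼 i', choi (D ∘ₗ jammed N ℓ σ ∘ₗ E) (i, i) (i', i') := by
  simp only [fidOp_apply, trace_mul_expect, trace_mul_jammerEffect_dual]

theorem trace_idTensor_maxEntangled (T : SuperOp (Fin L) (Fin L)) :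
    (idTensor T (maxEntangled L) * maxEntangled L).trace =
      𝔼 i, 𝔼 i', choi T (i, i) (i', i') := by
  have hT : ∀ p q, idTensor T (maxEntangled L) p q = (L : ℂ)⁻¹ * choi T p q := fun p q => by
    have hblock : (of fun x y => maxEntangled L (p.1, x) (q.1, y)) =
        (L : ℂ)⁻¹ • single p.1 q.1 (1 : ℂ) := by
      ext x y
      simp [maxEntangled, single_apply]
    simp only [idTensor, of_apply, hblock, map_smul, Matrix.smul_apply, smul_eq_mul, choi]
  simp only [Matrix.trace, diag_apply, Matrix.mul_apply, hT, Fintype.sum_prod_type]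
  simp only [maxEntangled, of_apply, ite_and, mul_ite, mul_zero, Finset.sum_ite_irrel,
    Finset.sum_const_zero, Finset.sum_ite_eq, Finset.mem_univ, if_true,
    Fintype.expect_eq_sum_div_card, Fintype.card_fin, div_eq_mul_inv, Finset.sum_mul]
  refine Finset.sum_congr rfl fun i _ => Finset.sum_congr rfl fun i' _ => ?_
  ring

theorem fidOp_nonneg (hN : IsCP N) {E : SuperOp l (Fin ℓ → a)} {D : SuperOp (Fin ℓ → b) l}
    (hE : IsCP E) (hD : IsCP D) : 0 ≤ fidOp N ℓ E D :=
  nonneg_of_forall_state fun σ => by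
    rw [trace_mul_fidOp]
    exact expect_entries_nonneg
      ((hD.comp ((IsCP.jammed hN ℓ σ).comp hE)).choi_nonneg.posSemidef.submatrix
        fun i => (i, i)).nonneg

theorem fidOp_le (hN : IsCP N) {E : SuperOp l (Fin ℓ → a)} {D : SuperOp (Fin ℓ → b) l}
    (hE : IsCP E) (hD : IsCP D) :
    fidOp N ℓ E D ≤ 𝔼 i, jammerEffect N ℓ (E (single i i 1)) (dual D (single i i 1)) := by
  refine sub_nonneg.1 (nonneg_of_forall_state fun σ => ?_)
  rw [mul_sub, trace_sub, sub_nonneg, trace_mul_fidOp, trace_mul_expect]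
  simp only [trace_mul_jammerEffect_dual]
  exact expect_entries_le_expect_diag
    ((hD.comp ((IsCP.jammed hN ℓ σ).comp hE)).choi_nonneg.posSemidef.submatrix
      fun i => (i, i)).nonneg

/-- The infidelity operator of a quantum code: its expectation in a jammer state is the
infidelity. -/
def QuantumCode.infidOp (Q : QuantumCode a b ℓ L) (N : SuperOp (a × j) b) : BlockOp j ℓ :=
  1 - fidOp N ℓ Q.E Q.D

theorem QuantumCode.infid_eq_expect (Q : QuantumCode a b ℓ L) (N : SuperOp (a × j) b)
    (σ : State (Fin ℓ → j)) : Q.infid N σ = σ.expect (Q.infidOp N) := by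
  rw [QuantumCode.infidOp, map_sub, State.expect_one, State.expect_apply, trace_mul_fidOp,
    ← trace_idTensor_maxEntangled]
  rfl

theorem QuantumCode.infidOp_le_one (hN : IsCPTP N) (Q : QuantumCode a b ℓ L) :
    Q.infidOp N ≤ 1 :=
  sub_le_self _ (fidOp_nonneg hN.completelyPositive Q.isCPTP_E.completelyPositive
    Q.isCPTP_D.completelyPositive)

/-- The classical code which sends the basis states through a quantum code. -/
def QuantumCode.toClassical (Q : QuantumCode a b ℓ L) : ClassicalCode a b ℓ L where
  ρ i := State.map Q.isCPTP_E (State.basis i)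
  D i := dual Q.D (single i i 1)
  posSemidef i :=
    ((IsCP.dual Q.isCPTP_D.completelyPositive).map_nonneg (single_self_nonneg i)).posSemidef
  sum_eq_one := by
    rw [← map_sum, sum_single_one, dual_one_eq_one_iff.2 Q.isCPTP_D.tracePreserving]

theorem QuantumCode.errOp_toClassical_le (hN : IsCPTP N) (Q : QuantumCode a b ℓ L) :
    Q.toClassical.errOp N ≤ Q.infidOp N := by
  simp only [ClassicalCode.errOp, jammerEffect_one_sub hN, Finset.expect_sub_distrib]
  exact sub_le_sub (expect_le_of_nonneg PosSemidef.one.nonneg fun _ _ => le_rfl)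
    (fidOp_le hN.completelyPositive Q.isCPTP_E.completelyPositive Q.isCPTP_D.completelyPositive)

theorem QuantumCode.infidOp_nonneg (hN : IsCPTP N) (Q : QuantumCode a b ℓ L) :
    0 ≤ Q.infidOp N :=
  (Q.toClassical.errOp_nonneg hN).trans (Q.errOp_toClassical_le hN)

end Fidelity

section QuantumConcatenation

variable {a j b : Type*} [Fintype a] [DecidableEq a] [Fintype j] [DecidableEq j] [Fintype b]
  [DecidableEq b] {N : SuperOp (a × j) b} {ℓ m n L K : ℕ}

theorem fidOp_tensor {l : Type*} [Fintype l] [DecidableEq l] (N : SuperOp (a × j) b)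
    (ρ : BlockOp a m) (D₁ : BlockOp b m) (E : SuperOp l (Fin n → a)) (D : SuperOp (Fin n → b) l) :
    fidOp N (m + n) (tensor ρ ∘ₗ E) (D ∘ₗ dual (tensor D₁)) =
      tensor (jammerEffect N m ρ D₁) (fidOp N n E D) := by
  simp only [fidOp_apply, dual_comp, dual_dual, LinearMap.comp_apply, jammerEffect_tensor,
    linearMap_expect]

/-- The quantum code which first sends a uniformly random index `k` with the classical code `C` and
then uses the quantum code `Q k`. -/
def QuantumCode.concat [NeZero K] (C : ClassicalCode a b m K)
    (Q : Fin K → QuantumCode a b n L) : QuantumCode a b (m + n) L where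
  E := 𝔼 k, tensor (C.ρ k).1 ∘ₗ (Q k).E
  D := ∑ k, (Q k).D ∘ₗ dual (tensor (C.D k))
  isCPTP_E :=
    { completelyPositive := IsCP.expect fun k _ =>
        (isCP_tensor (C.ρ k).2.1.nonneg).comp (Q k).isCPTP_E.completelyPositive
      tracePreserving := fun X => by
        have hk : ∀ k, (tensor (C.ρ k).1 ((Q k).E X)).trace = X.trace := fun k => by
          rw [trace_tensor, (C.ρ k).2.2, one_mul, (Q k).isCPTP_E.tracePreserving]
        refine (linearMap_expect (traceLinearMap _ ℂ ℂ ∘ₗ LinearMap.applyₗ X) _ _).trans ?_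
        simp [hk] }
  isCPTP_D :=
    { completelyPositive := IsCP.sum fun k _ =>
        IsCP.comp (Q k).isCPTP_D.completelyPositive (isCP_tensor (C.D_nonneg k)).dual
      tracePreserving := dual_one_eq_one_iff.1 <| by
        simp only [map_sum, LinearMap.sum_apply, dual_comp, dual_dual, LinearMap.comp_apply,
          dual_one_eq_one_iff.2 (Q _).isCPTP_D.tracePreserving]
        rw [← LinearMap.sum_apply, ← map_sum, C.sum_eq_one, tensor_one_one] }

theorem QuantumCode.fidOp_concat [NeZero K] (C : ClassicalCode a b m K)
    (Q : Fin K → QuantumCode a b n L) (N : SuperOp (a × j) b) :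
    fidOp N (m + n) (concat C Q).E (concat C Q).D =
      𝔼 k, ∑ k', tensor (jammerEffect N m (C.ρ k).1 (C.D k')) (fidOp N n (Q k).E (Q k').D) := by
  have hE := linearMap_expect ((fidOp N (m + n)).flip (concat C Q).D) Finset.univ
    fun k => tensor (C.ρ k).1 ∘ₗ (Q k).E
  refine hE.trans (Finset.expect_congr rfl fun k _ => ?_)
  rw [LinearMap.flip_apply]
  simp only [concat, map_sum, fidOp_tensor]

theorem QuantumCode.exists_concat (hN : IsCPTP N) [NeZero K] {e : ℝ}
    (hC : HasCode N m K e) (Q : Fin K → QuantumCode a b n L) :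
    ∃ Q' : QuantumCode a b (m + n) L,
      Q'.infidOp N ≤ e • 1 + tensor 1 (𝔼 k, (Q k).infidOp N) := by
  obtain ⟨C, hC⟩ := hC
  let X : Fin K → Fin K → BlockOp j (m + n) := fun k k' =>
    tensor (jammerEffect N m (C.ρ k).1 (C.D k')) (fidOp N n (Q k).E (Q k').D)
  have hX : ∀ k k', 0 ≤ X k k' := fun k k' =>
    tensor_nonneg (jammerEffect_nonneg hN (C.ρ k).2.1.nonneg (C.D_nonneg k'))
      (fidOp_nonneg hN.completelyPositive (Q k).isCPTP_E.completelyPositive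
        (Q k').isCPTP_D.completelyPositive)
  have hk : ∀ k, 1 - ∑ k', X k k' ≤ e • 1 + tensor 1 ((Q k).infidOp N) := fun k => by
    have hdiag : X k k ≤ ∑ k', X k k' :=
      Finset.single_le_sum (fun k' _ => hX k k') (Finset.mem_univ k)
    have hindex : 1 - jammerEffect N m (C.ρ k).1 (C.D k) ≤ e • 1 :=
      jammerEffect_one_sub hN (C.ρ k) (C.D k) ▸ hC k
    exact (sub_le_sub_left hdiag 1).trans (one_sub_tensor_le
      (jammerEffect_le_one hN _ (C.D_le_one k)) hindex
      (sub_nonneg.1 ((Q k).infidOp_nonneg hN)))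
  refine ⟨concat C Q, ?_⟩
  calc (concat C Q).infidOp N = 𝔼 k, (1 - ∑ k', X k k') := by
        rw [infidOp, fidOp_concat, Finset.expect_sub_distrib, Fintype.expect_const]
    _ ≤ 𝔼 k, (e • 1 + tensor 1 ((Q k).infidOp N)) := Finset.expect_le_expect fun k _ => hk k
    _ = e • 1 + tensor 1 (𝔼 k, (Q k).infidOp N) := by
        rw [Finset.expect_add_distrib, Fintype.expect_const, linearMap_expect]

/-- The preparation `t ↦ t ρ` of an operator `ρ` from the one-dimensional system. -/
def prepare {n : Type*} (ρ : Matrix n n ℂ) : SuperOp (Fin 1) n :=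
  (reindexLinearEquiv ℂ ℂ (Equiv.uniqueProd n (Fin 1))
    (Equiv.uniqueProd n (Fin 1))).toLinearMap ∘ₗ kroneckerBilinear.flip ρ

theorem prepare_one {n : Type*} (ρ : Matrix n n ℂ) : prepare ρ 1 = ρ := by
  ext x x'
  exact one_mul _

theorem isCP_prepare {n : Type*} [Finite n] {ρ : Matrix n n ℂ} (hρ : 0 ≤ ρ) :
    IsCP (prepare ρ) :=
  (isCP_reindex _).comp (isCP_kronecker_flip hρ)

/-- The quantum code for a one-dimensional system. -/
def QuantumCode.trivial (ρ : State (Fin ℓ → a)) : QuantumCode a b ℓ 1 where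
  E := prepare ρ.1
  D := dual (prepare 1)
  isCPTP_E := ⟨isCP_prepare ρ.2.1.nonneg, fun X => by
    rw [prepare, LinearMap.comp_apply, LinearEquiv.coe_coe, trace_reindexLinearEquiv]
    exact (trace_kronecker X ρ.1).trans (by rw [ρ.2.2, mul_one])⟩
  isCPTP_D := ⟨(isCP_prepare PosSemidef.one.nonneg).dual, dual_one_eq_one_iff.1 <| by
    rw [dual_dual, prepare_one]⟩

theorem QuantumCode.infidOp_trivial (hN : IsCPTP N) (ρ : State (Fin ℓ → a)) :
    (QuantumCode.trivial ρ : QuantumCode a b ℓ 1).infidOp N = 0 := by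
  have hone : single (0 : Fin 1) (0 : Fin 1) (1 : ℂ) = 1 := by
    ext x y
    rw [Subsingleton.elim x 0, Subsingleton.elim y 0, single_apply_same, one_apply_eq]
  rw [QuantumCode.infidOp, fidOp_apply]
  simp [hone, QuantumCode.trivial, dual_dual, prepare_one, jammerEffect_one hN]

end QuantumConcatenation

section Words

variable {α β κ : Type*}

theorem exists_comp_eq [Fintype α] [Nonempty α] [DecidableEq β] {p : ℕ} (g : α → β)
    (h : (Finset.univ.image g).card ≤ p) : ∃ (u : Fin p → β) (v : α → Fin p), u ∘ v = g := by
  have hg : ∀ t, g t ∈ Finset.univ.image g := fun t => Finset.mem_image_of_mem g (Finset.mem_univ t)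
  have hne : Nonempty (Finset.univ.image g) := ⟨⟨_, hg (Classical.arbitrary α)⟩⟩
  obtain ⟨e⟩ : Nonempty (Finset.univ.image g ↪ Fin p) :=
    Function.Embedding.nonempty_of_card_le (by rwa [Fintype.card_coe, Fintype.card_fin])
  refine ⟨fun i => (Function.invFun e i).1, fun t => e ⟨g t, hg t⟩, funext fun t => ?_⟩
  simp only [Function.comp_apply, Function.leftInverse_invFun e.injective _]

/-- The words indexed by `α`, with letters in `κ`, in which no letter occurs exactly once. -/
def repetitiveWords (α κ : Type*) [Fintype α] [DecidableEq α] [Fintype κ] [DecidableEq κ] :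
    Finset (α → κ) :=
  {g | ∀ t, ∃ t', t' ≠ t ∧ g t' = g t}

theorem card_repetitiveWords_le [Fintype α] [DecidableEq α] [Nonempty α] [Fintype κ] [DecidableEq κ]
    {p : ℕ} (h : Fintype.card α ≤ 2 * p) :
    (repetitiveWords α κ).card ≤ Fintype.card κ ^ p * p ^ Fintype.card α := by
  have hsub : repetitiveWords α κ ⊆
      Finset.univ.image fun q : (Fin p → κ) × (α → Fin p) => q.1 ∘ q.2 := fun g hg => by
    have himage : 2 * (Finset.univ.image g).card ≤ Fintype.card α := by
      refine Finset.mul_card_image_le_card _ 2 fun k hk => ?_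
      obtain ⟨t, -, rfl⟩ := Finset.mem_image.1 hk
      obtain ⟨t', ht', hgt⟩ := (Finset.mem_filter.1 hg).2 t
      exact Finset.one_lt_card.2 ⟨t, by simp, t', by simp [hgt], ht'.symm⟩
    obtain ⟨u, v, huv⟩ := exists_comp_eq (p := p) g (by omega)
    exact Finset.mem_image.2 ⟨(u, v), Finset.mem_univ _, huv⟩
  refine (Finset.card_le_card hsub).trans (Finset.card_image_le.trans_eq ?_)
  simp

end Words

section Moments

variable {α ι κ : Type*} [Fintype ι] [Fintype κ] [DecidableEq κ]

theorem sum_prod_eq_one {R : Type*} [CommSemiring R] {w : ι → R} (hw : ∑ i, w i = 1) :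
    ∑ f : κ → ι, ∏ k, w (f k) = 1 := by
  rw [← Fintype.piFinset_univ, ← Finset.prod_univ_sum (fun _ => Finset.univ) fun _ i => w i]
  simp [hw]

theorem exists_le_of_sum_mul_le {w x : ι → ℝ} {B : ℝ} (hw0 : ∀ i, 0 ≤ w i) (hw1 : ∑ i, w i = 1)
    (h : ∑ i, w i * x i ≤ B) : ∃ i, x i ≤ B := by
  obtain ⟨i, -, hi⟩ := (concaveOn_id convex_univ).exists_le_of_centerMass
    (t := Finset.univ) (p := x) (fun i _ => hw0 i) (by simp [hw1]) fun _ _ => Set.mem_univ _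
  refine ⟨i, hi.trans ?_⟩
  simpa only [id_eq, Finset.centerMass_eq_of_sum_1 _ _ hw1, smul_eq_mul] using h

-- Integrating out the letter `g t` alone replaces the argument at `t` by the mean of `Y`.
theorem sum_prod_smul_map_eq_zero {R M M' : Type*} [CommSemiring R] [AddCommMonoid M]
    [AddCommMonoid M'] [Module R M] [Module R M'] {w : ι → R} {Y : ι → M}
    (h0 : ∑ i, w i • Y i = 0) (φ : MultilinearMap R (fun _ : α => M) M') {g : α → κ} {t : α}
    (ht : ∀ t', t' ≠ t → g t' ≠ g t) :
    ∑ f : κ → ι, (∏ k, w (f k)) • φ (fun s => Y (f (g s))) = 0 := by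
  classical
  rw [← (Equiv.funSplitAt (g t) ι).symm.sum_comp, Fintype.sum_prod_type, Finset.sum_comm]
  refine Finset.sum_eq_zero fun f' _ => ?_
  let Z : α → M := fun s => if h : g s = g t then 0 else Y (f' ⟨g s, h⟩)
  have hword : ∀ i, (fun s => Y ((Equiv.funSplitAt (g t) ι).symm (i, f') (g s))) =
      Function.update Z t (Y i) := fun i => funext fun s => by
    by_cases hs : s = t
    · subst hs
      simp [Equiv.funSplitAt, Equiv.piSplitAt]
    · simp [Equiv.funSplitAt, Equiv.piSplitAt, Function.update_of_ne hs, Z, ht s hs]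
  have hweight : ∀ i, ∏ k, w ((Equiv.funSplitAt (g t) ι).symm (i, f') k) =
      (∏ k : {k // k ≠ g t}, w (f' k)) * w i := fun i => by
    rw [Fintype.prod_eq_mul_prod_subtype_ne _ (g t), mul_comm]
    congr 1
    · exact Finset.prod_congr rfl fun k _ => by simp [Equiv.funSplitAt, Equiv.piSplitAt, k.2]
    · simp [Equiv.funSplitAt, Equiv.piSplitAt]
  calc ∑ i, (∏ k, w ((Equiv.funSplitAt (g t) ι).symm (i, f') k)) •
        φ (fun s => Y ((Equiv.funSplitAt (g t) ι).symm (i, f') (g s)))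
      = (∏ k : {k // k ≠ g t}, w (f' k)) • ∑ i, φ (Function.update Z t (w i • Y i)) := by
        simp only [hword, hweight, mul_smul, Finset.smul_sum, MultilinearMap.map_update_smul]
    _ = 0 := by
        rw [← MultilinearMap.map_update_sum, h0, MultilinearMap.map_coord_zero _ t (by simp),
          smul_zero]

variable {A : Type*} [NormedRing A] [NormedAlgebra ℝ A] {w : ι → ℝ} {Y : ι → A} {c : ℝ} {m : ℕ}

theorem norm_sum_prod_smul_word_le (hw0 : ∀ i, 0 ≤ w i) (hw1 : ∑ i, w i = 1)
    (hY : ∀ i, ‖Y i‖ ≤ c) (hm : 0 < m) (g : Fin m → κ) :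
    ‖∑ f : κ → ι, (∏ k, w (f k)) • MultilinearMap.mkPiAlgebraFin ℝ m A fun s => Y (f (g s))‖ ≤
      c ^ m := by
  have hword : ∀ f : κ → ι, ‖MultilinearMap.mkPiAlgebraFin ℝ m A fun s => Y (f (g s))‖ ≤ c ^ m :=
    fun f => by
      rw [MultilinearMap.mkPiAlgebraFin_apply]
      refine (List.norm_prod_le' (by simp [hm.ne'])).trans ?_
      rw [List.map_ofFn, List.prod_ofFn]
      exact (Finset.prod_le_prod (fun _ _ => norm_nonneg _) fun s _ => hY _).trans_eq (by simp)
  have hweight : ∀ f : κ → ι, 0 ≤ ∏ k, w (f k) := fun f => Finset.prod_nonneg fun k _ => hw0 _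
  calc _ ≤ ∑ f : κ → ι, (∏ k, w (f k)) * c ^ m := norm_sum_le_of_le _ fun f _ => by
        rw [norm_smul, Real.norm_of_nonneg (hweight f)]
        exact mul_le_mul_of_nonneg_left (hword f) (hweight f)
    _ = c ^ m := by rw [← Finset.sum_mul, sum_prod_eq_one hw1, one_mul]

theorem norm_sum_prod_smul_pow_le (hw0 : ∀ i, 0 ≤ w i) (hw1 : ∑ i, w i = 1)
    (hY : ∀ i, ‖Y i‖ ≤ c) (h0 : ∑ i, w i • Y i = 0) {p : ℕ} (hm : 0 < m) (hmp : m ≤ 2 * p) :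
    ‖∑ f : κ → ι, (∏ k, w (f k)) • (∑ k, Y (f k)) ^ m‖ ≤
      Fintype.card κ ^ p * p ^ m * c ^ m := by
  have hne : Nonempty (Fin m) := ⟨⟨0, hm⟩⟩
  let F : (Fin m → κ) → A := fun g =>
    ∑ f : κ → ι, (∏ k, w (f k)) • MultilinearMap.mkPiAlgebraFin ℝ m A fun s => Y (f (g s))
  have hF : ∀ g, g ∉ repetitiveWords (Fin m) κ → F g = 0 := fun g hg => by
    simp only [repetitiveWords, Finset.mem_filter_univ, not_forall, not_exists, not_and] at hg
    obtain ⟨t, ht⟩ := hg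
    exact sum_prod_smul_map_eq_zero h0 _ ht
  have hcard : ((repetitiveWords (Fin m) κ).card : ℝ) ≤ Fintype.card κ ^ p * p ^ m := by
    have h := card_repetitiveWords_le (κ := κ) ((Fintype.card_fin m).trans_le hmp)
    rw [Fintype.card_fin] at h
    exact_mod_cast h
  have hc : 0 ≤ c := by
    obtain ⟨i, -, -⟩ := Finset.exists_ne_zero_of_sum_ne_zero (hw1.trans_ne one_ne_zero)
    exact (norm_nonneg _).trans (hY i)
  have hexp : ∀ f : κ → ι, (∑ k, Y (f k)) ^ m =
      ∑ g : Fin m → κ, MultilinearMap.mkPiAlgebraFin ℝ m A fun s => Y (f (g s)) := fun f => by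
    rw [← MultilinearMap.mkPiAlgebraFin_apply_const (R := ℝ)]
    exact MultilinearMap.map_sum _ fun _ k => Y (f k)
  calc _ = ‖∑ g, F g‖ := by
        simp only [hexp, Finset.smul_sum, F]
        rw [Finset.sum_comm]
    _ = ‖∑ g ∈ repetitiveWords (Fin m) κ, F g‖ := by
        rw [Finset.sum_subset (Finset.subset_univ _) fun g _ hg => hF g hg]
    _ ≤ (repetitiveWords (Fin m) κ).card * c ^ m := by
        refine (norm_sum_le_of_le _ fun g _ =>
          norm_sum_prod_smul_word_le hw0 hw1 hY hm g).trans_eq ?_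
        rw [Finset.sum_const, nsmul_eq_mul]
    _ ≤ Fintype.card κ ^ p * p ^ m * c ^ m := by gcongr

end Moments

section TraceMoments

open scoped Matrix.Norms.L2Operator

variable {n ι : Type*} [Fintype n] [DecidableEq n] [Fintype ι]

theorem norm_trace_le (X : Matrix n n ℂ) : ‖X.trace‖ ≤ Fintype.card n * ‖X‖ := by
  have hdiag : ∀ i, ‖X i i‖ ≤ ‖X‖ := fun i => by
    have hcol := Matrix.l2_opNorm_mulVec X (EuclideanSpace.single i 1)
    rw [PiLp.norm_single, norm_one, mul_one] at hcol
    refine le_trans (le_of_eq ?_) ((PiLp.norm_apply_le _ i).trans hcol)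
    simp
  refine (norm_sum_le_of_le _ fun i _ => hdiag i).trans_eq ?_
  rw [Finset.sum_const, Finset.card_univ, nsmul_eq_mul]

theorem exists_trace_pow_le {w : ι → ℝ} (hw0 : ∀ i, 0 ≤ w i) (hw1 : ∑ i, w i = 1)
    {Y : ι → Matrix n n ℂ} {c : ℝ} (hY : ∀ i, ‖Y i‖ ≤ c) (h0 : ∑ i, w i • Y i = 0) {p m : ℕ}
    (hm : 0 < m) (hmp : m ≤ 2 * p) (K : ℕ) :
    ∃ f : Fin K → ι, ((∑ k, Y (f k)) ^ m).trace.re ≤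
      Fintype.card n * (K ^ p * p ^ m * c ^ m) := by
  refine exists_le_of_sum_mul_le (w := fun f : Fin K → ι => ∏ k, w (f k))
    (fun f => Finset.prod_nonneg fun k _ => hw0 _) (sum_prod_eq_one hw1) ?_
  have hmean := norm_sum_prod_smul_pow_le (κ := Fin K) hw0 hw1 hY h0 hm hmp
  rw [Fintype.card_fin] at hmean
  calc _ = (∑ f : Fin K → ι, (∏ k, w (f k)) • (∑ k, Y (f k)) ^ m).trace.re := by
        simp only [trace_sum, trace_smul, Complex.re_sum, Complex.smul_re, smul_eq_mul]
    _ ≤ _ := (Complex.re_le_norm _).trans <|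
        (norm_trace_le _).trans <| mul_le_mul_of_nonneg_left hmean (Nat.cast_nonneg _)

theorem trace_pow_eq_sum_eigenvalues_pow {T : Matrix n n ℂ} (hT : T.IsHermitian) (m : ℕ) :
    (T ^ m).trace = ∑ i, (hT.eigenvalues i : ℂ) ^ m := by
  conv_lhs => rw [hT.spectral_theorem]
  rw [← map_pow, Unitary.conjStarAlgAut_apply, trace_mul_cycle, Unitary.coe_star_mul_self, one_mul,
    diagonal_pow, trace_diagonal]
  rfl

theorem le_smul_one_of_eigenvalues_le {T : Matrix n n ℂ} (hT : T.IsHermitian) {c : ℝ}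
    (h : ∀ i, hT.eigenvalues i ≤ c) : T ≤ c • (1 : Matrix n n ℂ) := by
  rw [← Algebra.algebraMap_eq_smul_one]
  refine le_algebraMap_of_spectrum_le (fun x hx => ?_) hT.isSelfAdjoint
  obtain ⟨i, rfl⟩ := hT.spectrum_real_eq_range_eigenvalues ▸ hx
  exact h i

theorem le_smul_one_of_trace_pow_le {T : Matrix n n ℂ} (hT : T.IsHermitian) {c : ℝ} (hc : 0 ≤ c)
    {m : ℕ} (hm : m ≠ 0) (heven : Even m) (h : (T ^ m).trace.re ≤ c ^ m) :
    T ≤ c • (1 : Matrix n n ℂ) := by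
  refine le_smul_one_of_eigenvalues_le hT fun i => ?_
  have htrace : (T ^ m).trace.re = ∑ i, hT.eigenvalues i ^ m := by
    rw [trace_pow_eq_sum_eigenvalues_pow hT]
    exact_mod_cast Complex.ofReal_re _
  have hpow : |hT.eigenvalues i| ^ m ≤ c ^ m := calc
    |hT.eigenvalues i| ^ m = hT.eigenvalues i ^ m := heven.pow_abs _
    _ ≤ ∑ i, hT.eigenvalues i ^ m :=
      Finset.single_le_sum (fun i _ => heven.pow_nonneg _) (Finset.mem_univ i)
    _ ≤ c ^ m := htrace ▸ h
  exact (le_abs_self _).trans (le_of_pow_le_pow_left₀ hm hc hpow)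

theorem expect_le_add_smul_of_sum_sub_le {E : Type*} [AddCommGroup E] [PartialOrder E]
    [IsOrderedAddMonoid E] [Module ℝ E] [PosSMulMono ℝ E] [Module ℚ≥0 E] {K : ℕ} (hK : 0 < K)
    {V : Fin K → E} {a b : E} {t : ℝ} (h : ∑ k, (V k - a) ≤ (t * K) • b) :
    𝔼 k, V k ≤ a + t • b := by
  have hK0 : (K : ℝ) ≠ 0 := by positivity
  have hKne : Nonempty (Fin K) := ⟨⟨0, hK⟩⟩
  refine sub_le_iff_le_add'.1 ?_
  calc 𝔼 k, V k - a = 𝔼 k, (V k - a) := by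
        rw [Finset.expect_sub_distrib, Fintype.expect_const]
    _ = (K : ℝ)⁻¹ • ∑ k, (V k - a) := by
        rw [Finset.expect, ← NNRat.cast_smul_eq_nnqsmul ℝ]
        simp
    _ ≤ (K : ℝ)⁻¹ • (t * K) • b := smul_le_smul_of_nonneg_left h (by positivity)
    _ = t • b := by rw [smul_smul, mul_comm t, inv_mul_cancel_left₀ hK0]

theorem exists_average_le {w : ι → ℝ} (hw0 : ∀ i, 0 ≤ w i) (hw1 : ∑ i, w i = 1)
    {W : ι → Matrix n n ℂ} (hW0 : ∀ i, 0 ≤ W i) (hW1 : ∀ i, W i ≤ 1) {p K : ℕ} (hp : 0 < p)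
    (hK : 0 < K) {t : ℝ} (ht : 0 ≤ t)
    (h : (Fintype.card n : ℝ) * (4 * p ^ 2 * K) ^ p ≤ (t * K) ^ (2 * p)) :
    ∃ f : Fin K → ι, 𝔼 k, W (f k) ≤ ∑ i, w i • W i + t • (1 : Matrix n n ℂ) := by
  set A := ∑ i, w i • W i with hA
  have hA0 : 0 ≤ A := Finset.sum_nonneg fun i _ => smul_nonneg (hw0 i) (hW0 i)
  have hA1 : A ≤ 1 := calc
    A ≤ ∑ i, w i • (1 : Matrix n n ℂ) :=
      Finset.sum_le_sum fun i _ => smul_le_smul_of_nonneg_left (hW1 i) (hw0 i)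
    _ = 1 := by rw [← Finset.sum_smul, hw1, one_smul]
  have hnorm : ∀ X : Matrix n n ℂ, 0 ≤ X → X ≤ 1 → ‖X‖ ≤ 1 := fun X h0 h1 =>
    (CStarAlgebra.norm_le_one_iff_of_nonneg X h0).2 h1
  have hcentered_norm : ∀ i, ‖W i - A‖ ≤ 2 := fun i => by
    linarith [norm_sub_le (W i) A, hnorm _ (hW0 i) (hW1 i), hnorm _ hA0 hA1]
  have hcentered_mean : ∑ i, w i • (W i - A) = 0 := by
    simp only [smul_sub, Finset.sum_sub_distrib, ← Finset.sum_smul, hw1, one_smul, ← hA, sub_self]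
  obtain ⟨f, hf⟩ := exists_trace_pow_le hw0 hw1 hcentered_norm hcentered_mean
    (Nat.mul_pos two_pos hp) le_rfl K
  have hherm : (∑ k, (W (f k) - A)).IsHermitian := isSelfAdjoint_sum _ fun k _ =>
    (hW0 (f k)).posSemidef.isHermitian.sub hA0.posSemidef.isHermitian
  refine ⟨f, expect_le_add_smul_of_sum_sub_le hK ?_⟩
  refine le_smul_one_of_trace_pow_le hherm (by positivity) (by positivity) (even_two_mul p)
    (hf.trans (le_trans (le_of_eq ?_) h))
  have hfour : (2 : ℝ) ^ (2 * p) = 4 ^ p := by rw [pow_mul]; norm_num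
  rw [hfour, mul_pow, mul_pow, ← pow_mul]
  ring

end TraceMoments

section RandomOperators

open scoped Matrix.Norms.L2Operator
open MeasureTheory

variable {n Λ : Type*} [Fintype n] [MeasurableSpace Λ] {P : Measure Λ}

theorem dotProduct_mulVec_polarization (X : Matrix n n ℂ) (u v : n → ℂ) :
    star u ⬝ᵥ X *ᵥ v = 1 / 2 * ((star (u + v) ⬝ᵥ X *ᵥ (u + v) -
      (star u ⬝ᵥ X *ᵥ u + star v ⬝ᵥ X *ᵥ v)) - Complex.I *
        (star (u + Complex.I • v) ⬝ᵥ X *ᵥ (u + Complex.I • v) -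
          (star u ⬝ᵥ X *ᵥ u + star v ⬝ᵥ X *ᵥ v))) := by
  simp only [mulVec_add, mulVec_smul, star_add, star_smul, add_dotProduct, dotProduct_add,
    smul_dotProduct, dotProduct_smul, smul_eq_mul, Complex.star_def, Complex.conj_I]
  linear_combination (star u ⬝ᵥ X *ᵥ v - star v ⬝ᵥ X *ᵥ u -
    Complex.I * (star v ⬝ᵥ X *ᵥ v)) / 2 * Complex.I_sq

variable [DecidableEq n]

theorem integrable_of_forall_apply {W : Λ → Matrix n n ℂ}
    (h : ∀ x y, Integrable (fun t => W t x y) P) : Integrable W P := by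
  have hsum : W = fun t => ∑ x, ∑ y, W t x y • Matrix.single x y (1 : ℂ) := funext fun t => by
    conv_lhs => rw [Matrix.matrix_eq_sum_single (W t)]
    simp only [smul_single, smul_eq_mul, mul_one]
  rw [hsum]
  exact integrable_finsetSum _ fun x _ => integrable_finsetSum _ fun y _ => (h x y).smul_const _

theorem integrable_of_forall_expect {W : Λ → Matrix n n ℂ} (hW : ∀ t, (W t).IsHermitian)
    (hint : ∀ σ : State n, Integrable (fun t => σ.expect (W t)) P) : Integrable W P := by
  have hform : ∀ v : n → ℂ, Integrable (fun t => star v ⬝ᵥ W t *ᵥ v) P := fun v => by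
    by_cases hv : v = 0
    · simp [hv]
    obtain ⟨σ, hσ⟩ := exists_state_dotProduct_mulVec hv
    simp only [hσ, ← σ.ofReal_expect (hW _)]
    exact (hint σ).ofReal.const_mul _
  refine integrable_of_forall_apply fun x y => ?_
  let u : n → ℂ := Pi.single x 1
  let v : n → ℂ := Pi.single y 1
  have hentry : ∀ t, W t x y = star u ⬝ᵥ W t *ᵥ v := fun t => by simp [u, v]
  have hpolar := ((hform (u + v)).sub ((hform u).add (hform v))).sub
    (((hform (u + Complex.I • v)).sub ((hform u).add (hform v))).const_mul Complex.I)
  exact (hpolar.const_mul (1 / 2)).congr <| Filter.Eventually.of_forall fun t =>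
    ((hentry t).trans (dotProduct_mulVec_polarization (W t) u v)).symm

theorem State.expect_integral (σ : State n) {W : Λ → Matrix n n ℂ} (hW : Integrable W P) :
    σ.expect (∫ t, W t ∂P) = ∫ t, σ.expect (W t) ∂P :=
  ((LinearMap.toContinuousLinearMap σ.expect).integral_comp_comm hW).symm

theorem isHermitian_integral {W : Λ → Matrix n n ℂ} (hW : ∀ t, (W t).IsHermitian) :
    (∫ t, W t ∂P).IsHermitian :=
  ((starL' ℝ (A := Matrix n n ℂ)).integral_comp_comm W).symm.trans
    (integral_congr_ae (Filter.Eventually.of_forall hW))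

-- The mean lies in the closed convex hull of the values.
theorem exists_sum_smul_le_integral_add [IsProbabilityMeasure P] {W : Λ → Matrix n n ℂ}
    (hW : ∀ t, (W t).IsHermitian) (hint : Integrable W P) {δ : ℝ} (hδ : 0 < δ) :
    ∃ (ι : Type) (_ : Fintype ι) (w : ι → ℝ) (s : ι → Λ), (∀ i, 0 ≤ w i) ∧ ∑ i, w i = 1 ∧
      ∑ i, w i • W (s i) ≤ ∫ t, W t ∂P + δ • (1 : Matrix n n ℂ) := by
  have hmem : ∫ t, W t ∂P ∈ closure (convexHull ℝ (Set.range W)) :=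
    (convex_convexHull ℝ _).closure.integral_mem isClosed_closure
      (Filter.Eventually.of_forall fun t =>
        subset_closure (subset_convexHull ℝ _ (Set.mem_range_self t))) hint
  obtain ⟨X, hX, hdist⟩ := Metric.mem_closure_iff.1 hmem δ hδ
  obtain ⟨ι, _, w, z, hw0, hw1, hz, rfl⟩ := mem_convexHull_iff_exists_fintype.1 hX
  choose s hs using hz
  have hherm : IsSelfAdjoint (∑ i, w i • z i - ∫ t, W t ∂P) := by
    refine (isSelfAdjoint_sum _ fun i _ => ?_).sub (isHermitian_integral hW)
    exact (IsSelfAdjoint.all (w i)).smul (hs i ▸ hW (s i))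
  refine ⟨ι, inferInstance, w, s, hw0, hw1, sub_le_iff_le_add'.1 ?_⟩
  simp only [hs]
  refine hherm.le_algebraMap_norm_self.trans ?_
  rw [Algebra.algebraMap_eq_smul_one, ← dist_eq_norm, dist_comm]
  exact smul_le_smul_of_nonneg_right hdist.le PosSemidef.one.nonneg

theorem exists_average_le_of_integral_expect_le [IsProbabilityMeasure P] {W : Λ → Matrix n n ℂ}
    (hW0 : ∀ t, 0 ≤ W t) (hW1 : ∀ t, W t ≤ 1)
    (hint : ∀ σ : State n, Integrable (fun t => σ.expect (W t)) P) {ε δ : ℝ} (hδ : 0 < δ)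
    (hε : ∀ σ : State n, ∫ t, σ.expect (W t) ∂P ≤ ε) {p K : ℕ} (hp : 0 < p)
    (hK : 0 < K) {t : ℝ} (ht : 0 ≤ t)
    (h : (Fintype.card n : ℝ) * (4 * p ^ 2 * K) ^ p ≤ (t * K) ^ (2 * p)) :
    ∃ f : Fin K → Λ, 𝔼 k, W (f k) ≤ (ε + δ + t) • (1 : Matrix n n ℂ) := by
  have hherm : ∀ t, (W t).IsHermitian := fun t => (hW0 t).posSemidef.isHermitian
  have hWint := integrable_of_forall_expect hherm hint
  have hmean : ∫ t, W t ∂P ≤ ε • (1 : Matrix n n ℂ) :=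
    le_smul_one_of_forall_expect_le (isHermitian_integral hherm) fun σ =>
      σ.expect_integral hWint ▸ hε σ
  obtain ⟨ι, _, w, s, hw0, hw1, hs⟩ := exists_sum_smul_le_integral_add hherm hWint hδ
  obtain ⟨f, hf⟩ := exists_average_le hw0 hw1 (fun i => hW0 (s i)) (fun i => hW1 (s i)) hp hK ht h
  refine ⟨fun k => s (f k), hf.trans ?_⟩
  rw [add_smul, add_smul]
  gcongr
  exact hs.trans (by gcongr)

end RandomOperators

section Limits

open scoped Topology
open Filter

variable {j : Type*} [Fintype j] [Nonempty j] {err err' : ∀ ℓ : ℕ, State (Fin ℓ → j) → ℝ}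

theorem errorVanishes_iff (h0 : ∀ ℓ σ, 0 ≤ err ℓ σ) :
    ErrorVanishes err ↔ ∀ δ > 0, ∀ᶠ ℓ in atTop, ∀ σ, err ℓ σ ≤ δ := by
  constructor
  · intro h δ hδ
    filter_upwards [h.eventually (gt_mem_nhds (EReal.coe_pos.2 hδ))] with ℓ hℓ σ
    exact EReal.coe_le_coe_iff.1 ((le_iSup (fun σ => (err ℓ σ : EReal)) σ).trans hℓ.le)
  · intro h
    refine tendsto_order.2 ⟨fun c hc => Eventually.of_forall fun ℓ => hc.trans_le ?_,
      fun c hc => ?_⟩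
    · have σ : State (Fin ℓ → j) := Classical.arbitrary _
      exact (EReal.coe_nonneg.2 (h0 ℓ σ)).trans (le_iSup (fun σ => (err ℓ σ : EReal)) σ)
    · obtain ⟨δ, hδ0, hδ⟩ := EReal.lt_iff_exists_real_btwn.1 hc
      filter_upwards [h δ (EReal.coe_pos.1 hδ0)] with ℓ hℓ
      exact (iSup_le fun σ => EReal.coe_le_coe_iff.2 (hℓ σ)).trans_lt hδ

theorem errorVanishes_zero :
    ErrorVanishes (fun _ _ => 0 : ∀ ℓ : ℕ, State (Fin ℓ → j) → ℝ) :=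
  (errorVanishes_iff fun _ _ => le_rfl).2 fun _ hδ =>
    Eventually.of_forall fun _ _ => le_of_lt hδ

theorem ErrorVanishes.mono (h : ErrorVanishes err') (h0 : ∀ ℓ σ, 0 ≤ err ℓ σ)
    (hle : ∀ ℓ σ, err ℓ σ ≤ err' ℓ σ) : ErrorVanishes err :=
  (errorVanishes_iff h0).2 fun δ hδ =>
    ((errorVanishes_iff fun ℓ σ => (h0 ℓ σ).trans (hle ℓ σ)).1 h δ hδ).mono
      fun ℓ hℓ σ => (hle ℓ σ).trans (hℓ σ)

theorem ErrorVanishes.tendsto_iSup (h : ErrorVanishes err) (h0 : ∀ ℓ σ, 0 ≤ err ℓ σ) :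
    Tendsto (fun ℓ => ⨆ σ, err ℓ σ) atTop (𝓝 0) := by
  refine tendsto_order.2 ⟨fun c hc => Eventually.of_forall fun ℓ =>
    hc.trans_le (Real.iSup_nonneg (h0 ℓ)), fun c hc => ?_⟩
  filter_upwards [(errorVanishes_iff h0).1 h (c / 2) (half_pos hc)] with ℓ hℓ
  exact (ciSup_le hℓ).trans_lt (half_lt_self hc)

end Limits

section Rates

open scoped Topology
open Filter

theorem logb_natCast_nonneg (K : ℕ) : 0 ≤ Real.logb 2 K := by
  rcases K.eq_zero_or_pos with rfl | h
  · simp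
  · exact Real.logb_nonneg one_lt_two (Nat.one_le_cast.2 h)

theorem asympRate_nonneg (K : ℕ → ℕ) : 0 ≤ asympRate K :=
  le_limsup_of_frequently_le' (Frequently.of_forall fun _ =>
    EReal.coe_nonneg.2 (div_nonneg (logb_natCast_nonneg _) (Nat.cast_nonneg _)))

theorem limsup_coe_le_limsup_coe_mul {ι : Type*} {f : Filter ι} {x u : ι → ℝ}
    (hu : Tendsto u f (𝓝 1)) :
    limsup (fun i => (x i : EReal)) f ≤ limsup (fun i => ((x i * u i : ℝ) : EReal)) f := by
  refine le_of_forall_lt fun c hc => ?_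
  obtain ⟨c', hcc', hc'⟩ := EReal.lt_iff_exists_real_btwn.1 hc
  obtain ⟨r, hc'r, hr⟩ := EReal.lt_iff_exists_real_btwn.1 hc'
  have hru : Tendsto (fun i => r * u i) f (𝓝 r) := by simpa using hu.const_mul r
  have hfreq := frequently_lt_of_lt_limsup (by isBoundedDefault) hr
  refine hcc'.trans_le (le_limsup_of_frequently_le' ((hfreq.and_eventually
    ((hru.eventually (lt_mem_nhds (EReal.coe_lt_coe_iff.1 hc'r))).and
      (hu.eventually (lt_mem_nhds one_pos)))).mono ?_))
  rintro i ⟨hrx, hcr, hui⟩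
  exact EReal.coe_le_coe_iff.2
    (hcr.le.trans (mul_le_mul_of_nonneg_right (EReal.coe_lt_coe_iff.1 hrx).le hui.le))

theorem asympRate_le_of_tendsto {φ M M' : ℕ → ℕ} (hφ : Tendsto φ atTop atTop)
    (hlim : Tendsto (fun n : ℕ => (n : ℝ) / φ n) atTop (𝓝 1))
    (hM : ∀ᶠ n in atTop, M' (φ n) = M n) : asympRate M ≤ asympRate M' := by
  have hrate : ∀ᶠ n in atTop, ((Real.logb 2 (M n) / n * (n / φ n) : ℝ) : EReal) =
      ((Real.logb 2 (M' (φ n)) / φ n : ℝ) : EReal) := by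
    filter_upwards [hM, eventually_ne_atTop 0] with n hn hn0
    rw [hn, div_mul_div_cancel₀ (Nat.cast_ne_zero.2 hn0)]
  calc asympRate M
      ≤ limsup (fun n => ((Real.logb 2 (M n) / n * (n / φ n) : ℝ) : EReal)) atTop :=
        limsup_coe_le_limsup_coe_mul hlim
    _ = limsup (fun n => ((Real.logb 2 (M' (φ n)) / φ n : ℝ) : EReal)) atTop :=
        limsup_congr hrate
    _ ≤ asympRate M' :=
        limsup_le_limsup_of_le (u := fun ℓ : ℕ => ((Real.logb 2 (M' ℓ) / ℓ : ℝ) : EReal)) hφ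

theorem tendsto_div_add_self {s : ℕ → ℕ} (hs : Tendsto (fun n => (s n : ℝ) / n) atTop (𝓝 0)) :
    Tendsto (fun n : ℕ => (n : ℝ) / (s n + n : ℕ)) atTop (𝓝 1) := by
  have h : Tendsto (fun n : ℕ => ((s n : ℝ) / n + 1)⁻¹) atTop (𝓝 1) := by
    simpa using (hs.add_const 1).inv₀ (by norm_num)
  refine h.congr' ?_
  filter_upwards [eventually_ne_atTop 0] with n hn
  have hn' : (n : ℝ) ≠ 0 := Nat.cast_ne_zero.2 hn
  rw [div_add_one hn', inv_div, Nat.cast_add]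

theorem exists_sequence {G : ℕ → ℕ → ℝ → Prop} (htriv : ∀ ℓ, G ℓ 1 0) {φ : ℕ → ℕ}
    (hφ : StrictMono φ) (hlim : Tendsto (fun n : ℕ => (n : ℝ) / φ n) atTop (𝓝 1)) {M : ℕ → ℕ}
    {e : ℕ → ℝ} (he : Tendsto e atTop (𝓝 0)) (hG : ∀ᶠ n in atTop, G (φ n) (M n) (e n)) :
    ∃ (M' : ℕ → ℕ) (e' : ℕ → ℝ), (∀ ℓ, G ℓ (M' ℓ) (e' ℓ)) ∧ Tendsto e' atTop (𝓝 0) ∧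
      asympRate M ≤ asympRate M' := by
  obtain ⟨n₀, hn₀⟩ := eventually_atTop.1 hG
  let ψ : {n // n₀ ≤ n} → ℕ := fun n => φ n
  have hψ : ψ.Injective := hφ.injective.comp Subtype.val_injective
  let M' : ℕ → ℕ := Function.extend ψ (fun n => M n) 1
  let e' : ℕ → ℝ := Function.extend ψ (fun n => e n) 0
  have hM' : ∀ n, M' (ψ n) = M n := hψ.extend_apply _ _
  have he' : ∀ n, e' (ψ n) = e n := hψ.extend_apply _ _
  refine ⟨M', e', fun ℓ => ?_, ?_, asympRate_le_of_tendsto hφ.tendsto_atTop hlim ?_⟩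
  · by_cases hℓ : ∃ n, ψ n = ℓ
    · obtain ⟨n, rfl⟩ := hℓ
      rw [hM', he']
      exact hn₀ n n.2
    · simpa only [M', e', Function.extend_apply' _ _ _ hℓ, Pi.one_apply, Pi.zero_apply]
        using htriv ℓ
  · rw [Metric.tendsto_atTop] at he ⊢
    intro δ hδ
    obtain ⟨n₁, hn₁⟩ := he δ hδ
    refine ⟨φ n₁, fun ℓ hℓ => ?_⟩
    by_cases hℓ' : ∃ n, ψ n = ℓ
    · obtain ⟨n, rfl⟩ := hℓ'
      rw [he']
      exact hn₁ n (hφ.le_iff_le.1 hℓ)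
    · simpa only [e', Function.extend_apply' _ _ _ hℓ', Pi.zero_apply, dist_self] using hδ
  · filter_upwards [eventually_ge_atTop n₀] with n hn
    exact hM' ⟨n, hn⟩

end Rates

section Parameters

open scoped Topology
open Filter

/-- The number of bits of the code index that is sent ahead of a code of block length `n`. It is a
power of two between `4 * log₂ n` and `8 * (log₂ n + 1)`, since amplification doubles the exponent
of the error. -/
def indexBits (n : ℕ) : ℕ := 2 ^ (Nat.log 2 (Nat.log 2 n) + 3)

theorem monotone_indexBits : Monotone indexBits := fun _ _ h =>
  Nat.pow_le_pow_right two_pos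
    (Nat.add_le_add_right (Nat.log_mono_right (Nat.log_mono_right h)) 3)

theorem indexBits_le (n : ℕ) : indexBits n ≤ 8 * (Nat.log 2 n + 1) := by
  have h : 2 ^ Nat.log 2 (Nat.log 2 n) ≤ Nat.log 2 n + 1 := by
    rcases (Nat.log 2 n).eq_zero_or_pos with h0 | h0
    · simp [h0]
    · exact (Nat.pow_log_le_self 2 h0.ne').trans (Nat.le_succ _)
  rw [indexBits, pow_add, mul_comm]
  exact Nat.mul_le_mul_left 8 h

theorem sq_le_two_pow_log_log (n : ℕ) : n ^ 2 ≤ 2 ^ 2 ^ (Nat.log 2 (Nat.log 2 n) + 2) := by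
  have hlog : Nat.log 2 n + 1 ≤ 2 ^ (Nat.log 2 (Nat.log 2 n) + 1) :=
    Nat.lt_pow_succ_log_self one_lt_two _
  calc n ^ 2 ≤ (2 ^ (Nat.log 2 n + 1)) ^ 2 :=
        Nat.pow_le_pow_left (Nat.lt_pow_succ_log_self one_lt_two _).le 2
    _ = 2 ^ ((Nat.log 2 n + 1) * 2) := (pow_mul 2 _ 2).symm
    _ ≤ 2 ^ (2 ^ (Nat.log 2 (Nat.log 2 n) + 1) * 2) :=
        Nat.pow_le_pow_right two_pos (Nat.mul_le_mul_right 2 hlog)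

theorem pow_four_le_two_pow_indexBits (n : ℕ) : n ^ 4 ≤ 2 ^ indexBits n := by
  have h := Nat.pow_le_pow_left (sq_le_two_pow_log_log n) 2
  rwa [← pow_mul, ← pow_mul, ← pow_succ] at h

theorem indexBits_mul_half_pow_le {n : ℕ} (hn : 0 < n) :
    (indexBits n : ℝ) * (1 / 2) ^ indexBits n ≤ 2 / n := by
  set y := 2 ^ (Nat.log 2 (Nat.log 2 n) + 2)
  have hbits : indexBits n = y * 2 := pow_succ 2 _
  have hy_le : (y : ℝ) ≤ 2 ^ y := by exact_mod_cast Nat.lt_two_pow_self.le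
  have hn_le : (n : ℝ) ≤ 2 ^ y := by
    exact_mod_cast (Nat.le_self_pow two_ne_zero n).trans (sq_le_two_pow_log_log n)
  have hn' : (0 : ℝ) < n := Nat.cast_pos.2 hn
  rw [hbits, _root_.one_div_pow, mul_one_div, div_le_div_iff₀ (by positivity) hn', pow_mul]
  calc ((y * 2 : ℕ) : ℝ) * n = 2 * (y * n) := by push_cast; ring
    _ ≤ 2 * (2 ^ y * 2 ^ y) := by gcongr
    _ = 2 * (2 ^ y) ^ 2 := by rw [sq]

theorem tendsto_log_pow_div (m : ℕ) :
    Tendsto (fun n => ((Nat.log 2 n + 1 : ℕ) : ℝ) ^ m / n) atTop (𝓝 0) := by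
  have hlog : Tendsto (Nat.log 2) atTop atTop :=
    tendsto_atTop_atTop.2 fun b => ⟨2 ^ b, fun n hn => Nat.le_log_of_pow_le one_lt_two hn⟩
  have hpow : Tendsto (fun k : ℕ => 2 * (((k + 1 : ℕ) : ℝ) ^ m / 2 ^ (k + 1))) atTop (𝓝 0) := by
    simpa using ((tendsto_pow_const_div_const_pow_of_one_lt m (one_lt_two (α := ℝ))).comp
      (tendsto_add_atTop_nat 1)).const_mul 2
  refine squeeze_zero' (Eventually.of_forall fun n => by positivity) ?_ (hpow.comp hlog)
  filter_upwards [eventually_ne_atTop 0] with n hn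
  have hn_ge : (2 : ℝ) ^ Nat.log 2 n ≤ n := by exact_mod_cast Nat.pow_log_le_self 2 hn
  calc ((Nat.log 2 n + 1 : ℕ) : ℝ) ^ m / n ≤ ((Nat.log 2 n + 1 : ℕ) : ℝ) ^ m / 2 ^ Nat.log 2 n := by
        gcongr
    _ = 2 * (((Nat.log 2 n + 1 : ℕ) : ℝ) ^ m / 2 ^ (Nat.log 2 n + 1)) := by
        rw [pow_succ 2 (Nat.log 2 n)]
        field_simp

theorem tendsto_indexBits_pow_div (m c : ℕ) :
    Tendsto (fun n => ((indexBits n ^ m * c : ℕ) : ℝ) / n) atTop (𝓝 0) := by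
  have h := (tendsto_log_pow_div m).const_mul ((8 : ℝ) ^ m * c)
  rw [mul_zero] at h
  refine squeeze_zero (fun n => by positivity) (fun n => ?_) h
  have hbits : (indexBits n : ℝ) ≤ 8 * (Nat.log 2 n + 1 : ℕ) := by exact_mod_cast indexBits_le n
  calc ((indexBits n ^ m * c : ℕ) : ℝ) / n ≤ (8 * (Nat.log 2 n + 1 : ℕ)) ^ m * c / n := by
        push_cast at hbits ⊢
        gcongr
    _ = 8 ^ m * c * (((Nat.log 2 n + 1 : ℕ) : ℝ) ^ m / n) := by ring

theorem pow_mul_pow_le_pow_two_mul {d n K : ℕ} (hn : 0 < n) (hK : n ^ 4 ≤ K) :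
    ((d ^ n : ℕ) : ℝ) * (4 * n ^ 2 * K) ^ n ≤ (2 * √d / n * K) ^ (2 * n) := by
  have hn' : (0 : ℝ) < n := Nat.cast_pos.2 hn
  have hK' : (n : ℝ) ^ 4 ≤ K := by exact_mod_cast hK
  have hbase : (d : ℝ) * (4 * n ^ 2 * K) ≤ (2 * √d / n * K) ^ 2 := by
    rw [mul_pow, div_pow, mul_pow, Real.sq_sqrt (Nat.cast_nonneg d), div_mul_eq_mul_div,
      le_div_iff₀ (pow_pos hn' 2)]
    calc (d : ℝ) * (4 * n ^ 2 * K) * (n : ℝ) ^ 2 = 2 ^ 2 * d * ((n : ℝ) ^ 4 * K) := by ring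
      _ ≤ 2 ^ 2 * d * ((K : ℝ) * K) := by gcongr
      _ = 2 ^ 2 * d * (K : ℝ) ^ 2 := by rw [sq (K : ℝ)]
  rw [pow_mul, Nat.cast_pow, ← mul_pow]
  exact pow_le_pow_left₀ (by positivity) hbase n

end Parameters

section Derandomization

open scoped Topology
open MeasureTheory Filter

variable {a j b : Type*} [Fintype a] [DecidableEq a] [Fintype j] [DecidableEq j] [Fintype b]
  [DecidableEq b] {N : SuperOp (a × j) b}

theorem ClassicalCode.err_nonneg (hN : IsCPTP N) {ℓ M : ℕ} (C : ClassicalCode a b ℓ M)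
    (σ : State (Fin ℓ → j)) : 0 ≤ C.err N σ :=
  (σ.expect_nonneg (C.errOp_nonneg hN)).trans_eq (C.err_eq_expect N σ).symm

theorem exists_hasTest [Nonempty j] (hN : IsCPTP N) (h : 0 < Cdet N) {ε : ℝ} (hε : 0 < ε) :
    ∃ ℓ, HasTest N ℓ ε ε := by
  obtain ⟨R, ⟨M, C, hC, rfl⟩, hR⟩ := lt_sSup_iff.1 h
  have herr := (errorVanishes_iff fun ℓ => (C ℓ).err_nonneg hN).1 hC (ε / 3) (by positivity)
  obtain ⟨ℓ, hrate, hℓ⟩ :=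
    ((frequently_lt_of_lt_limsup (by isBoundedDefault) hR).and_eventually herr).exists
  have hM : 2 ≤ M ℓ := by
    by_contra! hM
    have hM' : M ℓ = 0 ∨ M ℓ = 1 := by omega
    rcases hM' with h | h <;> simp [h] at hrate
  have herrOp : (C ℓ).errOp N ≤ (ε / 3) • 1 :=
    le_smul_one_of_forall_expect_le ((C ℓ).errOp_nonneg hN).posSemidef.isHermitian fun σ =>
      ((C ℓ).err_eq_expect N σ).symm.trans_le (hℓ σ)
  have htest := (C ℓ).hasTest hN hM herrOp
  rw [mul_div_cancel₀ ε three_ne_zero] at htest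
  exact ⟨ℓ, htest⟩

theorem HasTest.hasCode_indexBits [Nonempty a] (hN : IsCPTP N) {ℓ : ℕ}
    (h : HasTest N ℓ (1 / 8) (1 / 8)) {n : ℕ} (hn : 0 < n) :
    ∃ e : ℝ, 0 ≤ e ∧ e ≤ 2 / n ∧ HasCode N (indexBits n ^ 3 * ℓ) (2 ^ indexBits n) e := by
  set r := Nat.log 2 (Nat.log 2 n) + 3 with hr
  have hcode := (h.amplify hN (by norm_num) r).hasCode.pow hN (indexBits n)
  have hlength : indexBits n * (4 ^ r * ℓ) = indexBits n ^ 3 * ℓ := by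
    have hfour : 4 ^ r = indexBits n ^ 2 := by
      rw [indexBits, ← hr, ← pow_mul, mul_comm, pow_mul]
      norm_num
    rw [hfour]
    ring
  rw [hlength] at hcode
  refine ⟨_, by positivity, ?_, hcode⟩
  calc (indexBits n : ℝ) * ((4 * (1 / 8)) ^ 2 ^ r / 4)
      = (indexBits n : ℝ) * (1 / 2) ^ indexBits n / 4 := by
        rw [mul_div_assoc, indexBits, ← hr]
        norm_num
    _ ≤ (indexBits n : ℝ) * (1 / 2) ^ indexBits n := div_le_self (by positivity) (by norm_num)
    _ ≤ 2 / n := indexBits_mul_half_pow_le hn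

/-- The properties which the sets `S ℓ M` of the error operators of all codes of block length `ℓ`
and size `M` share for classical and for quantum codes, so that both can be derandomized alike. -/
structure IsErrorFamily (N : SuperOp (a × j) b) (S : ∀ ℓ _M : ℕ, Set (BlockOp j ℓ)) : Prop where
  nonneg : ∀ {ℓ M X}, X ∈ S ℓ M → 0 ≤ X
  le_one : ∀ {ℓ M X}, X ∈ S ℓ M → X ≤ 1
  zero_mem : ∀ ℓ, 0 ∈ S ℓ 1
  exists_concat : ∀ {m n K M : ℕ} [NeZero K] {e : ℝ}, 0 ≤ e → HasCode N m K e →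
    ∀ V : Fin K → BlockOp j n, (∀ k, V k ∈ S n M) →
      ∃ X ∈ S (m + n) M, X ≤ e • 1 + tensor 1 (𝔼 k, V k)

/-- The function `err` of the state is the mean of the expectations of a random operator in `S`. It
stands for the error of a random code. -/
def IsMeanError {n : Type*} [Fintype n] (S : Set (Matrix n n ℂ)) (err : State n → ℝ) : Prop :=
  ∃ (Λ : Type) (_ : MeasurableSpace Λ) (P : Measure Λ) (W : Λ → Matrix n n ℂ),
    IsProbabilityMeasure P ∧ (∀ t, W t ∈ S) ∧
      (∀ σ, Integrable (fun t => State.expect σ (W t)) P) ∧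
      ∀ σ, err σ = ∫ t, State.expect σ (W t) ∂P

theorem IsMeanError.nonneg {n : Type*} [Fintype n] {S : Set (Matrix n n ℂ)} {err : State n → ℝ}
    (h : IsMeanError S err) (hS : ∀ X ∈ S, 0 ≤ X) (σ : State n) : 0 ≤ err σ := by
  obtain ⟨Λ, _, P, W, _, hW, -, herr⟩ := h
  rw [herr σ]
  exact integral_nonneg fun t => σ.expect_nonneg (hS _ (hW t))

theorem IsMeanError.le_one {n : Type*} [Fintype n] [DecidableEq n] {S : Set (Matrix n n ℂ)}
    {err : State n → ℝ} (h : IsMeanError S err) (hS : ∀ X ∈ S, X ≤ 1) (σ : State n) :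
    err σ ≤ 1 := by
  obtain ⟨Λ, _, P, W, _, hW, hint, herr⟩ := h
  calc err σ = ∫ t, σ.expect (W t) ∂P := herr σ
    _ ≤ ∫ _, σ.expect 1 ∂P :=
        integral_mono (hint σ) (integrable_const _) fun t => σ.expect_mono (hS _ (hW t))
    _ = 1 := by rw [integral_const, probReal_univ, one_smul, σ.expect_one]

variable {S : ∀ ℓ _M : ℕ, Set (BlockOp j ℓ)}

theorem IsErrorFamily.exists_le_smul_one [Nonempty a] (hN : IsCPTP N) (hS : IsErrorFamily N S)
    {ℓ : ℕ} (htest : HasTest N ℓ (1 / 8) (1 / 8)) {n M : ℕ} (hn : 0 < n)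
    {err : State (Fin n → j) → ℝ} (herr : IsMeanError (S n M) err) {ε : ℝ}
    (hε : ∀ σ, err σ ≤ ε) :
    ∃ X ∈ S (indexBits n ^ 3 * ℓ + n) M, X ≤ (ε + (3 + 2 * √(Fintype.card j)) / n) • 1 := by
  obtain ⟨e, he0, he, hcode⟩ := htest.hasCode_indexBits hN hn
  obtain ⟨Λ, _, P, W, _, hW, hint, hmean⟩ := herr
  have hmoment := pow_mul_pow_le_pow_two_mul (d := Fintype.card j) hn
    (pow_four_le_two_pow_indexBits n)
  obtain ⟨f, hf⟩ := exists_average_le_of_integral_expect_le (fun t => hS.nonneg (hW t))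
    (fun t => hS.le_one (hW t)) hint (δ := 1 / n) (by positivity)
    (fun σ => (hmean σ).symm.trans_le (hε σ)) hn (K := 2 ^ indexBits n) (by positivity)
    (t := 2 * √(Fintype.card j) / n) (by positivity)
    (by rwa [Fintype.card_fun, Fintype.card_fin])
  obtain ⟨X, hX, hXle⟩ := hS.exists_concat he0 hcode (fun k => W (f k)) fun k => hW _
  refine ⟨X, hX, ?_⟩
  calc X ≤ e • 1 + tensor 1 (𝔼 k, W (f k)) := hXle
    _ ≤ (2 / n : ℝ) • 1 + tensor 1 ((ε + 1 / n + 2 * √(Fintype.card j) / n) • 1) :=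
        add_le_add (smul_le_smul_of_nonneg_right he PosSemidef.one.nonneg)
          (tensor_mono le_rfl hf PosSemidef.one.nonneg
            (Finset.expect_nonneg fun k _ => hS.nonneg (hW _)))
    _ = (ε + (3 + 2 * √(Fintype.card j)) / n) • 1 := by
        rw [tensor_one_smul_one, ← add_smul]
        congr 1
        ring

theorem IsErrorFamily.exists_deterministic [Nonempty a] [Nonempty j] (hN : IsCPTP N)
    (hC : 0 < Cdet N) (hS : IsErrorFamily N S) {M : ℕ → ℕ} {err : ∀ n, State (Fin n → j) → ℝ}
    (herr : ErrorVanishes err) (hmean : ∀ n, IsMeanError (S n (M n)) (err n)) :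
    ∃ (M' : ℕ → ℕ) (X : ∀ ℓ, BlockOp j ℓ), (∀ ℓ, X ℓ ∈ S ℓ (M' ℓ)) ∧
      ErrorVanishes (fun ℓ σ => σ.expect (X ℓ)) ∧ asympRate M ≤ asympRate M' := by
  obtain ⟨ℓ₀, htest⟩ := exists_hasTest hN hC (ε := 1 / 8) (by norm_num)
  have hbound : ∀ n σ, err n σ ≤ ⨆ σ, err n σ := fun n =>
    le_ciSup ⟨1, Set.forall_mem_range.2 ((hmean n).le_one fun _ => hS.le_one)⟩
  have hvanish : Tendsto (fun n : ℕ => (⨆ σ, err n σ) + (3 + 2 * √(Fintype.card j)) / (n : ℝ))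
      atTop (𝓝 0) := by
    simpa using (herr.tendsto_iSup fun n => (hmean n).nonneg fun _ => hS.nonneg).add
      (tendsto_const_div_atTop_nhds_zero_nat (3 + 2 * √(Fintype.card j)))
  have hlength : Monotone fun n => indexBits n ^ 3 * ℓ₀ := fun _ _ h =>
    Nat.mul_le_mul_right _ (Nat.pow_le_pow_left (monotone_indexBits h) 3)
  obtain ⟨M', e, hX, he, hrate⟩ := exists_sequence
    (G := fun ℓ M e => ∃ X ∈ S ℓ M, X ≤ e • 1) (fun ℓ => ⟨0, hS.zero_mem ℓ, (zero_smul ℝ _).ge⟩)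
    (hlength.add_strictMono strictMono_id)
    (tendsto_div_add_self (tendsto_indexBits_pow_div 3 ℓ₀)) hvanish
    ((eventually_gt_atTop 0).mono fun n hn =>
      hS.exists_le_smul_one hN htest hn (hmean n) (hbound n))
  choose X hX hXle using hX
  refine ⟨M', X, hX, ?_, hrate⟩
  refine (errorVanishes_iff fun ℓ σ => σ.expect_nonneg (hS.nonneg (hX ℓ))).2 fun δ hδ => ?_
  filter_upwards [he.eventually (gt_mem_nhds hδ)] with ℓ hℓ σ
  calc σ.expect (X ℓ) ≤ σ.expect (e ℓ • 1) := σ.expect_mono (hXle ℓ)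
    _ = e ℓ := by rw [map_smul, σ.expect_one, smul_eq_mul, mul_one]
    _ ≤ δ := hℓ.le

end Derandomization

section Capacities

open MeasureTheory Filter

variable {a j b : Type*} [Fintype a] [DecidableEq a] [Fintype j] [DecidableEq j] [Fintype b]

/-- A deterministic quantum code as a random code. -/
def QuantumCode.toRandom {ℓ L : ℕ} (Q : QuantumCode a b ℓ L) (N : SuperOp (a × j) b) :
    RandomQuantumCode N ℓ L where
  Λ := Unit
  mΛ := inferInstance
  P := Measure.dirac ()
  isProb := inferInstance
  code _ := Q
  integrable _ := integrable_const _

theorem QuantumCode.infid_toRandom {ℓ L : ℕ} (Q : QuantumCode a b ℓ L) (N : SuperOp (a × j) b)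
    (σ : State (Fin ℓ → j)) : (Q.toRandom N).infid σ = Q.infid N σ :=
  integral_dirac (fun _ => Q.infid N σ) ()

theorem Qdet_le_Qrand (N : SuperOp (a × j) b) : Qdet N ≤ Qrand N := by
  refine sSup_le_sSup ?_
  rintro R ⟨L, Q, hQ, rfl⟩
  exact ⟨L, fun ℓ => (Q ℓ).toRandom N, by simpa only [QuantumCode.infid_toRandom] using hQ, rfl⟩

theorem Qdet_nonneg [Nonempty a] [Nonempty j] {N : SuperOp (a × j) b} (hN : IsCPTP N) :
    0 ≤ Qdet N := by
  classical
  refine (asympRate_nonneg fun _ => 1).trans (le_sSup ⟨fun _ => 1, fun _ =>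
    QuantumCode.trivial (Classical.arbitrary _), ?_, rfl⟩)
  simpa only [QuantumCode.infid_eq_expect, QuantumCode.infidOp_trivial hN, map_zero] using
    errorVanishes_zero

variable [DecidableEq b] {N : SuperOp (a × j) b}

theorem isErrorFamily_range_errOp [Nonempty a] (hN : IsCPTP N) :
    IsErrorFamily N fun ℓ M => Set.range fun C : ClassicalCode a b ℓ M => C.errOp N where
  nonneg := by
    rintro ℓ M _ ⟨C, rfl⟩
    exact C.errOp_nonneg hN
  le_one := by
    rintro ℓ M _ ⟨C, rfl⟩
    exact C.errOp_le_one hN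
  zero_mem ℓ := ⟨ClassicalCode.trivial (Classical.arbitrary _), ClassicalCode.errOp_trivial N _⟩
  exists_concat := by
    intro m n K M _ e he hcode V hV
    choose C hC using hV
    obtain ⟨C', hC'⟩ := ClassicalCode.exists_concat hN he hcode C
    simp only [hC] at hC'
    exact ⟨_, ⟨C', rfl⟩, hC'⟩

theorem isErrorFamily_range_infidOp [Nonempty a] (hN : IsCPTP N) :
    IsErrorFamily N fun ℓ L => Set.range fun Q : QuantumCode a b ℓ L => Q.infidOp N where
  nonneg := by
    rintro ℓ L _ ⟨Q, rfl⟩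
    exact Q.infidOp_nonneg hN
  le_one := by
    rintro ℓ L _ ⟨Q, rfl⟩
    exact Q.infidOp_le_one hN
  zero_mem ℓ := ⟨QuantumCode.trivial (Classical.arbitrary _), QuantumCode.infidOp_trivial hN _⟩
  exists_concat := by
    intro m n K L _ e _ hcode V hV
    choose Q hQ using hV
    obtain ⟨Q', hQ'⟩ := QuantumCode.exists_concat hN hcode Q
    simp only [hQ] at hQ'
    exact ⟨_, ⟨Q', rfl⟩, hQ'⟩

theorem RandomClassicalCode.isMeanError {ℓ M : ℕ} (C : RandomClassicalCode N ℓ M) :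
    IsMeanError (Set.range fun C' : ClassicalCode a b ℓ M => C'.errOp N) C.err :=
  ⟨C.Λ, C.mΛ, C.P, fun t => (C.code t).errOp N, C.isProb, fun _ => ⟨_, rfl⟩,
    fun σ => by simpa only [ClassicalCode.err_eq_expect] using C.integrable σ,
    fun σ => by simp only [RandomClassicalCode.err, ClassicalCode.err_eq_expect]⟩

theorem RandomQuantumCode.isMeanError {ℓ L : ℕ} (Q : RandomQuantumCode N ℓ L) :
    IsMeanError (Set.range fun Q' : QuantumCode a b ℓ L => Q'.infidOp N) Q.infid :=
  ⟨Q.Λ, Q.mΛ, Q.P, fun t => (Q.code t).infidOp N, Q.isProb, fun _ => ⟨_, rfl⟩,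
    fun σ => by simpa only [QuantumCode.infid_eq_expect] using Q.integrable σ,
    fun σ => by simp only [RandomQuantumCode.infid, QuantumCode.infid_eq_expect]⟩

/-- A deterministic classical code as a random code. -/
def ClassicalCode.toRandom {ℓ M : ℕ} (C : ClassicalCode a b ℓ M) (N : SuperOp (a × j) b) :
    RandomClassicalCode N ℓ M where
  Λ := Unit
  mΛ := inferInstance
  P := Measure.dirac ()
  isProb := inferInstance
  code _ := C
  integrable _ := integrable_const _

theorem ClassicalCode.err_toRandom {ℓ M : ℕ} (C : ClassicalCode a b ℓ M) (N : SuperOp (a × j) b)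
    (σ : State (Fin ℓ → j)) : (C.toRandom N).err σ = C.err N σ :=
  integral_dirac (fun _ => C.err N σ) ()

theorem Cdet_le_Crand (N : SuperOp (a × j) b) : Cdet N ≤ Crand N := by
  refine sSup_le_sSup ?_
  rintro R ⟨M, C, hC, rfl⟩
  exact ⟨M, fun ℓ => (C ℓ).toRandom N, by simpa only [ClassicalCode.err_toRandom] using hC, rfl⟩

theorem Crand_le_Cdet [Nonempty a] [Nonempty j] (hN : IsCPTP N) (h : 0 < Cdet N) :
    Crand N ≤ Cdet N := by
  refine sSup_le ?_
  rintro R ⟨M, C, hC, rfl⟩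
  obtain ⟨M', X, hX, hX0, hrate⟩ := (isErrorFamily_range_errOp hN).exists_deterministic hN h hC
    fun n => (C n).isMeanError
  choose C' hC' using hX
  refine hrate.trans (le_sSup ⟨M', C', ?_, rfl⟩)
  simpa only [ClassicalCode.err_eq_expect, hC'] using hX0

theorem Qrand_le_Qdet [Nonempty a] [Nonempty j] (hN : IsCPTP N) (h : 0 < Cdet N) :
    Qrand N ≤ Qdet N := by
  refine sSup_le ?_
  rintro R ⟨L, Q, hQ, rfl⟩
  obtain ⟨L', X, hX, hX0, hrate⟩ := (isErrorFamily_range_infidOp hN).exists_deterministic hN h hQ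
    fun n => (Q n).isMeanError
  choose Q' hQ' using hX
  refine hrate.trans (le_sSup ⟨L', Q', ?_, rfl⟩)
  simpa only [QuantumCode.infid_eq_expect, hQ'] using hX0

theorem Cdet_nonneg [Nonempty a] [Nonempty j] (N : SuperOp (a × j) b) : 0 ≤ Cdet N := by
  refine (asympRate_nonneg fun _ => 1).trans (le_sSup ⟨fun _ => 1, fun _ =>
    ClassicalCode.trivial (Classical.arbitrary _), ?_, rfl⟩)
  simpa only [ClassicalCode.err_eq_expect, ClassicalCode.errOp_trivial, map_zero] using
    errorVanishes_zero

theorem Qdet_le_Cdet [Nonempty j] (hN : IsCPTP N) : Qdet N ≤ Cdet N := by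
  refine sSup_le_sSup ?_
  rintro R ⟨L, Q, hQ, rfl⟩
  refine ⟨L, fun ℓ => (Q ℓ).toClassical,
    hQ.mono (fun ℓ => (Q ℓ).toClassical.err_nonneg hN) fun ℓ σ => ?_, rfl⟩
  rw [ClassicalCode.err_eq_expect, QuantumCode.infid_eq_expect]
  exact σ.expect_mono ((Q ℓ).errOp_toClassical_le hN)

end Capacities

end QAVC

end

theorem corollary5 {a j b : Type*} [Fintype a] [DecidableEq a] [Nonempty a]
    [Fintype j] [DecidableEq j] [Nonempty j] [Fintype b] [DecidableEq b]
    (N : QAVC.SuperOp (a × j) b) (hN : QAVC.IsCPTP N) :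
    QAVC.Cdet N = (if 0 < QAVC.Cdet N then QAVC.Crand N else 0) ∧
      QAVC.Qdet N = (if 0 < QAVC.Cdet N then QAVC.Qrand N else 0) := by
  split_ifs with h
  · exact ⟨(QAVC.Cdet_le_Crand N).antisymm (QAVC.Crand_le_Cdet hN h),
      (QAVC.Qdet_le_Qrand N).antisymm (QAVC.Qrand_le_Qdet hN h)⟩
  · have h0 : QAVC.Cdet N = 0 := le_antisymm (not_lt.1 h) (QAVC.Cdet_nonneg N)
    exact ⟨h0, le_antisymm ((QAVC.Qdet_le_Cdet hN).trans h0.le) (QAVC.Qdet_nonneg hN)⟩
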